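/- Let quicksort be the basic algorithm on arrays of distinct keys: it takes the first key as pivot, compares each of the other keys once with the pivot (so $n-1$ comparisons are made for $n\ge 1$ keys, and none for the empty array), collects the smaller keys and the larger keys, each in their original order, and sorts the two parts recursively. Let $a_{n,k}$ be the number of permutations of $\{1,\dots,n\}$ for which quicksort makes exactly $k$ comparisons in total. For an integer $s\ge 1$ let $$\beta_s(n)=\sum_{k\ge 0}(k)_s\,\frac{a_{n,k}}{n!},\qquad (k)_s=k(k-1)\cdots(k-s+1),$$ be the $s$-th factorial moment of the number of comparisons for a uniformly random permutation, and let $f_s(u)=\sum_{n\ge 0}\beta_s(n)u^n$. Put $L(u)=\log\frac{1}{1-u}$ (principal branch), let $H_s=\sum_{i=1}^s \frac1i$, and let $\gamma$ be Euler's constant. Then for every integer $s\ge 1$ the series $f_s(u)$ converges for all complex $u$ with $|u|<1$, and there $$f_s(u)=\frac{2^s\,s!}{(1-u)^{s+1}}L(u)^s+\frac{s(H_s-2)\,2^s\,s!}{(1-u)^{s+1}}L(u)^{s-1}+R_s(u),$$ where $R_s(u)$ is a finite linear combination, with real coefficients not depending on $u$, of terms $L(u)^i(1-u)^{-j-1}$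 with integers $i\ge 0$ and $j$ such that either $j<s$, or $j=s$ and $i\le s-2$. Consequently, for every fixed integer $s\ge1$, as $n\to\infty$, $$\beta_s(n)=2^s n^s\log^s n+2^s s(\gamma-2)\,n^s\log^{s-1}n+O\!\left(n^s\log^{s-2}n\right).$$ -/

import Mathlib

open Asymptotics Filter

/-- The basic quicksort algorithm on a list. It returns the sorted list together with the number
of comparisons between keys. The first key `p` is the pivot; each of the remaining `l.length` keys
is compared once with `p`, the keys smaller than `p` and the other keys are collected in their
original order, and the two parts are sorted recursively. -/
def quicksort {α : Type*} [LinearOrder α] : List α → List α × ℕ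
  | [] => ([], 0)
  | p :: l =>
    let a := quicksort (l.filter (fun x => decide (x < p)))
    let b := quicksort (l.filter (fun x => !decide (x < p)))
    (a.1 ++ p :: b.1, l.length + a.2 + b.2)
termination_by l => l.length
decreasing_by
  all_goals
    simp only [List.length_cons, Nat.lt_succ_iff, List.length_unattach]
    exact (List.length_filter_le _ _).trans List.length_attach.le

/-- The number of comparisons quicksort needs for the array `σ(0), σ(1), …, σ(n-1)`. -/
def quicksortComparisons {n : ℕ} (σ : Equiv.Perm (Fin n)) : ℕ :=
  (quicksort (List.ofFn fun i => σ i)).2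

/-- `a_{n,k}`: the number of permutations of `n` keys for which quicksort needs exactly `k`
comparisons. -/
def quicksortCount (n k : ℕ) : ℕ :=
  (Finset.univ.filter fun σ : Equiv.Perm (Fin n) => quicksortComparisons σ = k).card

/-- `β_s(n) = ∑_{k ≥ 0} (k)_s a_{n,k} / n!`, the `s`-th factorial moment of the number of
comparisons. Only finitely many terms of the sum are nonzero. -/
noncomputable def quicksortMoment (s n : ℕ) : ℝ :=
  ∑' k : ℕ, (k.descFactorial s : ℝ) * ((quicksortCount n k : ℝ) / (n.factorial : ℝ))

/-- `f_s(u) = ∑_{n ≥ 0} β_s(n) u^n`. -/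
noncomputable def quicksortGF (s : ℕ) (u : ℂ) : ℂ :=
  ∑' n : ℕ, (quicksortMoment s n : ℂ) * u ^ n

/-- `L(u) = log (1 / (1 - u))`, with the principal branch (holomorphic for `|u| < 1`). -/
noncomputable def logTerm (u : ℂ) : ℂ := Complex.log (1 / (1 - u))

/-- `R` is, on the open unit disc, a finite linear combination with constant real coefficients of
terms `L(u)^i (1 - u)^(-j-1)`, where `i ≥ 0` and `j` are integers such that either `j < q`, or
`j = q` and `i ≤ p`. -/
def IsLowerOrder (p q : ℤ) (R : ℂ → ℂ) : Prop :=
  ∃ c : ℕ × ℤ →₀ ℝ,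
    (∀ x ∈ c.support, x.2 < q ∨ (x.2 = q ∧ (x.1 : ℤ) ≤ p)) ∧
    ∀ u : ℂ, ‖u‖ < 1 →
      R u = ∑ x ∈ c.support, (c x : ℂ) * (logTerm u ^ x.1 * (1 - u) ^ (-x.2 - 1))

/-! Given the first key, the two parts of a uniformly random permutation are independent and
uniform, and the pivot's rank is uniform. So the probability generating functions `P_n`, written in
`w = z - 1`, satisfy `(n+1) P_{n+1} = (1+w)^n ∑ P_i P_{n-i}` (`quicksortPGF_recursion`).

The coefficient of `w^s` in `P_n` is `β_s(n)/s!`. Distributing `(1+w)^n` over the two factors and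
summing over `n` gives, for `F_s = f_s/s!`, the identity `F_s' = ∑_{a+b=s} D_a D_b`, where `D_a`
generates the coefficients of `(1+w)^n P_n` (`derivative_momentSeries`). Since `D_0 = 1/(1-u)`, the
terms with `a = 0` or `b = 0` make this a linear equation `F_s' = 2F_s/(1-u) + h_s` whose `h_s`
involves only smaller `s`. Everything stays in the span of the series `L^i (1-u)^{-j}`. `HasTop`
records the two leading coefficients, `HasTop.of_derivative` carries them from `h_s` to `F_s`, and
`sum_mul_harmonic` closes the recursion for the second one. Absolute convergence then turns the
formal identity into the analytic one.

For the asymptotics, the coefficients of `L^i/(1-u)` are `H_n^i` up to an error two powers of the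
logarithm smaller (`exists_harmonicDefect_le`), and the operator `u d/du` raises the pole order.
Coefficient extraction brings in `γ - H_s`, which combines with `H_s - 2` to `γ - 2`. -/

/-! ### Orderings of a finite set and their splitting at a pivot. -/

section Arrangements

variable {α M : Type*} [DecidableEq α]

/-- The lists in which each element of `S` occurs exactly once. -/
def arrangements (S : Finset α) : Finset (List α) :=
  ⟨S.val.lists, Multiset.lists_nodup_finset S⟩

theorem mem_arrangements {S : Finset α} {l : List α} :
    l ∈ arrangements S ↔ l.Nodup ∧ l.toFinset = S := by
  change l ∈ S.val.lists ↔ _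
  rw [Multiset.mem_lists_iff]
  change S.val = (l : Multiset α) ↔ _
  constructor
  · intro h
    have hl : l.Nodup := by
      have := S.nodup
      rw [h] at this
      exact this
    refine ⟨hl, ?_⟩
    ext x
    rw [List.mem_toFinset, ← Finset.mem_val, h, Multiset.mem_coe]
  · rintro ⟨hl, rfl⟩
    rw [List.toFinset_val, hl.dedup]

theorem length_of_mem_arrangements {S : Finset α} {l : List α} (h : l ∈ arrangements S) :
    l.length = S.card := by
  obtain ⟨h1, rfl⟩ := mem_arrangements.1 h
  exact (List.toFinset_card_of_nodup h1).symm

theorem arrangements_empty : arrangements (∅ : Finset α) = {[]} := by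
  ext l
  simp only [mem_arrangements, Finset.mem_singleton, List.toFinset_eq_empty_iff]
  constructor
  · exact fun h => h.2
  · rintro rfl
    simp

theorem sum_arrangements [AddCommMonoid M] {S : Finset α} (hS : S.Nonempty) (f : List α → M) :
    ∑ l ∈ arrangements S, f l = ∑ x ∈ S, ∑ l ∈ arrangements (S.erase x), f (x :: l) := by
  rw [Finset.sum_sigma']
  symm
  refine Finset.sum_bij (fun p _ => p.1 :: p.2) ?_ ?_ ?_ ?_
  · rintro ⟨x, l⟩ h
    simp only [Finset.mem_sigma, mem_arrangements] at h ⊢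
    obtain ⟨hx, hl, hlS⟩ := h
    refine ⟨List.nodup_cons.2 ⟨?_, hl⟩, ?_⟩
    · rw [← List.mem_toFinset, hlS]
      exact Finset.notMem_erase x S
    · rw [List.toFinset_cons, hlS, Finset.insert_erase hx]
  · rintro ⟨x, l⟩ _ ⟨x', l'⟩ _ h
    simp only [List.cons.injEq] at h
    obtain ⟨rfl, rfl⟩ := h
    rfl
  · intro l hl
    obtain ⟨h1, h2⟩ := mem_arrangements.1 hl
    cases l with
    | nil => exact absurd h2.symm hS.ne_empty
    | cons x l =>
      refine ⟨⟨x, l⟩, ?_, rfl⟩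
      rw [List.nodup_cons] at h1
      rw [Finset.mem_sigma, mem_arrangements]
      subst h2
      refine ⟨by simp, h1.2, ?_⟩
      rw [List.toFinset_cons, Finset.erase_insert (by simpa using h1.1)]
  · intros; rfl

/-- Splitting an arrangement of `S` along a predicate `q`: every pair of arrangements of the two
parts arises from `S.card.choose k` arrangements, `k` being the size of the first part. -/
theorem sum_arrangements_filter [CommSemiring M] (q : α → Bool) (S : Finset α)
    (φ ψ : List α → M) :
    ∑ l ∈ arrangements S, φ (l.filter q) * ψ (l.filter fun x => !q x) =
      (S.card.choose (S.filter fun x => q x = true).card : M) *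
        ((∑ l ∈ arrangements (S.filter fun x => q x = true), φ l) *
          ∑ l ∈ arrangements (S.filter fun x => ¬ q x = true), ψ l) := by
  induction hn : S.card generalizing S φ ψ with
  | zero =>
    rw [Finset.card_eq_zero] at hn
    subst hn
    simp [arrangements_empty]
  | succ n ih =>
    have hS : S.Nonempty := Finset.card_pos.1 (by omega)
    rw [sum_arrangements hS, ← Finset.sum_filter_add_sum_filter_not S (fun x => q x = true)]
    set A := S.filter fun x => q x = true with hA
    set B := S.filter fun x => ¬ q x = true with hB
    have hAB : A.card + B.card = n + 1 := by
      rw [hA, hB, Finset.card_filter_add_card_filter_not, hn]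
    -- The first letter lies in `A` or in `B`; removing it leaves a splitting problem of size `n`.
    -- The two counts are recombined by Pascal's rule. If `A` is empty, the truncated `A.card - 1`
    -- is harmless because the sum over `A` vanishes.
    have h1 : ∑ x ∈ A, ∑ l ∈ arrangements (S.erase x),
        φ ((x :: l).filter q) * ψ ((x :: l).filter fun x => !q x) =
        (n.choose (A.card - 1) : M) * ((∑ x ∈ A, ∑ l ∈ arrangements (A.erase x), φ (x :: l)) *
          ∑ l ∈ arrangements B, ψ l) := by
      rw [Finset.sum_mul, Finset.mul_sum]
      refine Finset.sum_congr rfl fun x hx => ?_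
      obtain ⟨hxS, hxq⟩ := Finset.mem_filter.1 hx
      have h := ih (S.erase x) (fun l => φ (x :: l)) ψ (by rw [Finset.card_erase_of_mem hxS, hn]; rfl)
      have e1 : (S.erase x).filter (fun x => q x = true) = A.erase x := by
        rw [hA, Finset.filter_erase]
      have e2 : (S.erase x).filter (fun x => ¬ q x = true) = B := by
        rw [Finset.filter_erase, ← hB, Finset.erase_eq_of_notMem]
        simp [hB, hxq]
      rw [e1, e2, Finset.card_erase_of_mem hx] at h
      rw [← h]
      refine Finset.sum_congr rfl fun l _ => ?_
      simp [hxq]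
    have h2 : ∑ x ∈ B, ∑ l ∈ arrangements (S.erase x),
        φ ((x :: l).filter q) * ψ ((x :: l).filter fun x => !q x) =
        (n.choose A.card : M) * ((∑ l ∈ arrangements A, φ l) *
          ∑ x ∈ B, ∑ l ∈ arrangements (B.erase x), ψ (x :: l)) := by
      rw [Finset.mul_sum, Finset.mul_sum]
      refine Finset.sum_congr rfl fun x hx => ?_
      obtain ⟨hxS, hxq⟩ := Finset.mem_filter.1 hx
      have h := ih (S.erase x) φ (fun l => ψ (x :: l)) (by rw [Finset.card_erase_of_mem hxS, hn]; rfl)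
      have e1 : (S.erase x).filter (fun x => q x = true) = A := by
        rw [Finset.filter_erase, ← hA, Finset.erase_eq_of_notMem]
        simp [hA, hxq]
      have e2 : (S.erase x).filter (fun x => ¬ q x = true) = B.erase x := by
        rw [hB, Finset.filter_erase]
      rw [e1, e2] at h
      rw [← h]
      refine Finset.sum_congr rfl fun l _ => ?_
      simp [hxq]
    rw [h1, h2]
    rcases A.eq_empty_or_nonempty with hA0 | hA0
    · have hB0 : B.Nonempty := by
        rw [← Finset.card_pos]
        rw [hA0, Finset.card_empty] at hAB
        omega
      rw [← sum_arrangements hB0, hA0]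
      simp
    · rw [← sum_arrangements hA0]
      obtain ⟨k, hk⟩ : ∃ k, A.card = k + 1 := ⟨A.card - 1, by have := hA0.card_pos; omega⟩
      rcases B.eq_empty_or_nonempty with hB0 | hB0
      · have : k = n := by
          rw [hB0, Finset.card_empty] at hAB
          omega
        rw [hB0, hk, this]
        simp
      · rw [← sum_arrangements hB0, hk, Nat.choose_succ_succ]
        push_cast
        simp only [Nat.succ_eq_add_one]
        ring

theorem sum_perm_ofFn [AddCommMonoid M] (n : ℕ) (f : List (Fin n) → M) :
    ∑ σ : Equiv.Perm (Fin n), f (List.ofFn fun i => σ i) =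
      ∑ l ∈ arrangements (Finset.univ : Finset (Fin n)), f l := by
  refine Finset.sum_bij (fun σ _ => List.ofFn fun i => σ i) ?_ ?_ ?_ ?_
  · intro σ _
    rw [mem_arrangements, List.nodup_ofFn]
    refine ⟨σ.injective, ?_⟩
    ext x
    simpa [List.mem_ofFn] using σ.surjective x
  · intro σ _ τ _ h
    exact Equiv.ext fun i => congrFun (List.ofFn_injective h) i
  · intro l hl
    have hlen : l.length = n := by simpa using length_of_mem_arrangements hl
    obtain ⟨h1, -⟩ := mem_arrangements.1 hl
    have hinj : Function.Injective fun i : Fin n => l.get (Fin.cast hlen.symm i) :=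
      (List.nodup_iff_injective_get.1 h1).comp (Fin.cast_injective _)
    refine ⟨Equiv.ofBijective _ (Finite.injective_iff_bijective.1 hinj), Finset.mem_univ _, ?_⟩
    refine List.ext_getElem (by simp [hlen]) fun i h1 h2 => ?_
    simp
  · intros; rfl

end Arrangements

/-! ### The recursion for the probability generating functions and the moments. -/

/-- The rank of an element is strictly increasing and less than `S.card`, so by counting it is a
bijection onto the range. This is the uniformity of the pivot's rank. -/
theorem sum_card_filter_lt {α M : Type*} [LinearOrder α] [AddCommMonoid M] (S : Finset α)
    (f : ℕ → M) :
    ∑ p ∈ S, f (S.filter fun x => x < p).card = ∑ j ∈ Finset.range S.card, f j := by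
  have hmono : ∀ p ∈ S, ∀ p' ∈ S, p < p' →
      (S.filter fun x => x < p).card < (S.filter fun x => x < p').card := by
    intro p hp p' _ hlt
    refine Finset.card_lt_card ((Finset.ssubset_iff_of_subset fun x hx => ?_).2 ⟨p, ?_, ?_⟩)
    · rw [Finset.mem_filter] at hx ⊢
      exact ⟨hx.1, hx.2.trans hlt⟩
    · exact Finset.mem_filter.2 ⟨hp, hlt⟩
    · simp
  have hinj : Set.InjOn (fun p => (S.filter fun x => x < p).card) S := by
    intro p hp p' hp' h
    rcases lt_trichotomy p p' with hlt | rfl | hlt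
    · exact absurd h (hmono p hp p' hp' hlt).ne
    · rfl
    · exact absurd h (hmono p' hp' p hp hlt).ne'
  have himg : S.image (fun p => (S.filter fun x => x < p).card) = Finset.range S.card := by
    refine Finset.eq_of_subset_of_card_le ?_ ?_
    · intro j hj
      obtain ⟨p, hp, rfl⟩ := Finset.mem_image.1 hj
      refine Finset.mem_range.2 (Finset.card_lt_card (Finset.filter_ssubset.2 ⟨p, hp, by simp⟩))
    · rw [Finset.card_range, Finset.card_image_of_injOn hinj]
  rw [← himg, Finset.sum_image hinj]

open Polynomial in
/-- The probability generating function of the number of comparisons for `n` keys in random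
order, expanded at `1`. -/
noncomputable def quicksortPGF (n : ℕ) : ℝ[X] :=
  C ((n.factorial : ℝ)⁻¹) * ∑ σ : Equiv.Perm (Fin n), (1 + X) ^ quicksortComparisons σ

open Polynomial in
-- Strong induction on the number of keys; an arbitrary key set is allowed so that the hypothesis
-- applies to both parts. A pivot of rank `k` yields `n.choose k * k! * (n-k)! = n!` times the
-- product of the two smaller polynomials.
theorem sum_arrangements_quicksort {α : Type*} [LinearOrder α] {g : ℕ → ℝ[X]} (hg0 : g 0 = 1)
    (hg : ∀ n : ℕ, ((n : ℝ[X]) + 1) * g (n + 1) =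
      ∑ i ∈ Finset.range (n + 1), (1 + X) ^ n * (g i * g (n - i))) (S : Finset α) :
    ∑ l ∈ arrangements S, (1 + X : ℝ[X]) ^ (quicksort l).2 =
      (S.card.factorial : ℝ[X]) * g S.card := by
  induction hn : S.card using Nat.strong_induction_on generalizing S with
  | _ m ih =>
  subst hn
  rcases S.eq_empty_or_nonempty with rfl | hS
  · simp [arrangements_empty, quicksort, hg0]
  obtain ⟨n, hn⟩ : ∃ n, S.card = n + 1 := ⟨S.card - 1, by have := hS.card_pos; omega⟩
  rw [sum_arrangements hS]
  have key : ∀ p ∈ S, ∑ l ∈ arrangements (S.erase p), (1 + X : ℝ[X]) ^ (quicksort (p :: l)).2 =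
      (n.factorial : ℝ[X]) * ((1 + X) ^ n * (g (S.filter fun x => x < p).card *
        g (n - (S.filter fun x => x < p).card))) := by
    intro p hp
    have hcard : (S.erase p).card = n := by rw [Finset.card_erase_of_mem hp, hn]; rfl
    have e : (S.erase p).filter (fun x => decide (x < p) = true) = S.filter fun x => x < p := by
      ext x
      simp only [Finset.mem_filter, Finset.mem_erase, decide_eq_true_eq]
      exact ⟨fun h => ⟨h.1.2, h.2⟩, fun h => ⟨⟨h.2.ne, h.1⟩, h.2⟩⟩
    have hsplit := Finset.card_filter_add_card_filter_not (s := S.erase p)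
      (fun x => decide (x < p) = true)
    have hsum := sum_arrangements_filter (fun x => decide (x < p)) (S.erase p)
      (fun l => (1 + X : ℝ[X]) ^ (quicksort l).2) (fun l => (1 + X : ℝ[X]) ^ (quicksort l).2)
    rw [ih _ (by omega) _ rfl, ih _ (by omega) _ rfl] at hsum
    rw [hcard] at hsplit hsum
    rw [e] at hsplit hsum
    set k := (S.filter fun x => x < p).card
    have hk : ((S.erase p).filter (fun x => ¬ decide (x < p) = true)).card = n - k := by omega
    rw [hk] at hsum
    have hfac : (n.factorial : ℝ[X]) = (n.choose k : ℝ[X]) * (k.factorial : ℝ[X]) *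
        ((n - k).factorial : ℝ[X]) := by
      rw [← Nat.choose_mul_factorial_mul_factorial (show k ≤ n by omega)]
      push_cast
      rfl
    calc ∑ l ∈ arrangements (S.erase p), (1 + X : ℝ[X]) ^ (quicksort (p :: l)).2
        = (1 + X) ^ n * ∑ l ∈ arrangements (S.erase p),
            (1 + X : ℝ[X]) ^ (quicksort (l.filter fun x => decide (x < p))).2 *
            (1 + X : ℝ[X]) ^ (quicksort (l.filter fun x => !decide (x < p))).2 := by
          rw [Finset.mul_sum]
          refine Finset.sum_congr rfl fun l hl => ?_
          rw [quicksort, length_of_mem_arrangements hl, hcard, pow_add, pow_add, mul_assoc]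
      _ = _ := by
          rw [hsum, hfac]
          ring
  rw [Finset.sum_congr rfl key, ← Finset.mul_sum,
    sum_card_filter_lt S fun j => (1 + X : ℝ[X]) ^ n * (g j * g (n - j)), hn, ← hg,
    Nat.factorial_succ]
  push_cast
  ring

open Polynomial in
/-- The solution of the recursion for the probability generating functions. -/
noncomputable def quicksortPoly : ℕ → ℝ[X]
  | 0 => 1
  | n + 1 => C (((n : ℝ) + 1)⁻¹) * ∑ i : Fin (n + 1),
      (1 + X) ^ n * (quicksortPoly i * quicksortPoly (n - i))

open Polynomial in
theorem quicksortPoly_recursion (n : ℕ) : ((n : ℝ[X]) + 1) * quicksortPoly (n + 1) =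
    ∑ i ∈ Finset.range (n + 1), (1 + X) ^ n * (quicksortPoly i * quicksortPoly (n - i)) := by
  have h : ((n : ℝ[X]) + 1) * C (((n : ℝ) + 1)⁻¹) = 1 := by
    have : ((n : ℝ[X]) + 1) = C ((n : ℝ) + 1) := by simp
    rw [this, ← C_mul, mul_inv_cancel₀ (by positivity), C_1]
  rw [quicksortPoly, ← mul_assoc, h, one_mul,
    Fin.sum_univ_eq_sum_range fun i => (1 + X) ^ n * (quicksortPoly i * quicksortPoly (n - i))]

open Polynomial in
theorem quicksortPGF_recursion : quicksortPGF 0 = 1 ∧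
    ∀ n : ℕ, ((n : ℝ[X]) + 1) * quicksortPGF (n + 1) =
      ∑ i ∈ Finset.range (n + 1), (1 + X) ^ n * (quicksortPGF i * quicksortPGF (n - i)) := by
  have hg0 : quicksortPoly 0 = 1 := by rw [quicksortPoly]
  have : quicksortPGF = quicksortPoly := by
    funext n
    have h := sum_arrangements_quicksort hg0 quicksortPoly_recursion (Finset.univ : Finset (Fin n))
    rw [← sum_perm_ofFn n fun l => (1 + X : ℝ[X]) ^ (quicksort l).2, Finset.card_univ,
      Fintype.card_fin] at h
    have h' : ∑ σ : Equiv.Perm (Fin n), (1 + X : ℝ[X]) ^ quicksortComparisons σ =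
      (n.factorial : ℝ[X]) * quicksortPoly n := h
    have hc : (n.factorial : ℝ[X]) = C (n.factorial : ℝ) := by simp
    rw [quicksortPGF, h', hc, ← mul_assoc, ← C_mul, inv_mul_cancel₀ (by positivity), C_1, one_mul]
  rw [this]
  exact ⟨hg0, quicksortPoly_recursion⟩

theorem quicksortMoment_eq_sum (s n : ℕ) : quicksortMoment s n =
    (n.factorial : ℝ)⁻¹ *
      ∑ σ : Equiv.Perm (Fin n), ((quicksortComparisons σ).descFactorial s : ℝ) := by
  classical
  rw [quicksortMoment, tsum_eq_sum
    (s := Finset.univ.image fun σ : Equiv.Perm (Fin n) => quicksortComparisons σ)]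
  · rw [Finset.sum_comp (fun k => (k.descFactorial s : ℝ)) quicksortComparisons, Finset.mul_sum]
    refine Finset.sum_congr rfl fun k _ => ?_
    rw [quicksortCount, nsmul_eq_mul]
    ring
  · intro k hk
    have : quicksortCount n k = 0 := by
      rw [quicksortCount, Finset.card_eq_zero, Finset.filter_eq_empty_iff]
      intro σ _ h
      exact hk (Finset.mem_image.2 ⟨σ, Finset.mem_univ _, h⟩)
    simp [this]

/-- The coefficient of `X^s` in `(1+X)^k` is `k.choose s = (k)_s / s!`, so expanding at `1` turns
factorial moments into coefficients. -/
theorem coeff_quicksortPGF (s n : ℕ) :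
    (quicksortPGF n).coeff s = quicksortMoment s n / (s.factorial : ℝ) := by
  rw [quicksortMoment_eq_sum, quicksortPGF, Polynomial.coeff_C_mul, Polynomial.finsetSum_coeff,
    mul_div_assoc, Finset.sum_div]
  congr 1
  refine Finset.sum_congr rfl fun σ _ => ?_
  rw [Polynomial.coeff_one_add_X_pow, Nat.descFactorial_eq_factorial_mul_choose]
  push_cast
  field_simp

/-- The `s`-th binomial moment `β_s(n) / s!`. -/
noncomputable def binomialMoment (s n : ℕ) : ℝ := quicksortMoment s n / (s.factorial : ℝ)

/-- The `a`-th coefficient of `z ^ n` times the probability generating function at `z = 1 + w`. -/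
noncomputable def shiftedMoment (a n : ℕ) : ℝ :=
  ∑ p ∈ Finset.HasAntidiagonal.antidiagonal a, (n.choose p.1 : ℝ) * binomialMoment p.2 n

theorem coeff_one_add_X_pow_mul_quicksortPGF (a n : ℕ) :
    ((1 + Polynomial.X) ^ n * quicksortPGF n).coeff a = shiftedMoment a n := by
  rw [Polynomial.coeff_mul, shiftedMoment]
  refine Finset.sum_congr rfl fun p _ => ?_
  rw [Polynomial.coeff_one_add_X_pow, coeff_quicksortPGF, binomialMoment]

theorem binomialMoment_zero_right (s : ℕ) : binomialMoment s 0 = if s = 0 then 1 else 0 := by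
  rw [binomialMoment, ← coeff_quicksortPGF, quicksortPGF_recursion.1, Polynomial.coeff_one]

theorem binomialMoment_zero_left (n : ℕ) : binomialMoment 0 n = 1 := by
  rw [binomialMoment, quicksortMoment_eq_sum]
  simp [Fintype.card_perm, Nat.factorial_ne_zero]

theorem binomialMoment_recursion (s n : ℕ) : ((n : ℝ) + 1) * binomialMoment s (n + 1) =
    ∑ q ∈ Finset.HasAntidiagonal.antidiagonal s, ∑ p ∈ Finset.HasAntidiagonal.antidiagonal n,
      shiftedMoment q.1 p.1 * shiftedMoment q.2 p.2 := by
  have h := congrArg (fun f => Polynomial.coeff f s) (quicksortPGF_recursion.2 n)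
  have hc : ((n : Polynomial ℝ) + 1) = Polynomial.C ((n : ℝ) + 1) := by simp
  simp only [hc, Polynomial.coeff_C_mul, coeff_quicksortPGF] at h
  rw [binomialMoment, h, Finset.sum_comm, ← Finset.Nat.sum_antidiagonal_eq_sum_range_succ
    (fun i j => (1 + Polynomial.X) ^ n * (quicksortPGF i * quicksortPGF j)),
    Polynomial.finsetSum_coeff]
  refine Finset.sum_congr rfl fun p hp => ?_
  -- As `p.1 + p.2 = n`, each factor absorbs its own power of `1 + X`, so the sum becomes a genuine
  -- convolution.
  have e : (1 + Polynomial.X) ^ n * (quicksortPGF p.1 * quicksortPGF p.2) =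
      ((1 + Polynomial.X) ^ p.1 * quicksortPGF p.1) *
        ((1 + Polynomial.X) ^ p.2 * quicksortPGF p.2) := by
    rw [← Finset.HasAntidiagonal.mem_antidiagonal.1 hp, pow_add]
    ring
  rw [e, Polynomial.coeff_mul]
  simp only [coeff_one_add_X_pow_mul_quicksortPGF]

/-! ### Formal calculus of the series `L^i (1-u)^{-j}` and the linear differential equation. -/

section LogSeries

open PowerSeries

/-- The power series of `1 / (1 - u)`. -/
noncomputable def geomSeries : ℝ⟦X⟧ := PowerSeries.mk 1

/-- The power series of `log (1 / (1 - u))`. -/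
noncomputable def logSeries : ℝ⟦X⟧ := PowerSeries.mk fun n => (n : ℝ)⁻¹

theorem geomSeries_mul_one_sub_X : geomSeries * (1 - X) = 1 := mk_one_mul_one_sub_eq_one ℝ

theorem X_mul_geomSeries_pow_succ (j : ℕ) :
    X * geomSeries ^ (j + 1) = geomSeries ^ (j + 1) - geomSeries ^ j := by
  have h := geomSeries_mul_one_sub_X
  linear_combination (-geomSeries ^ j) * h

theorem derivative_geomSeries : d⁄dX ℝ geomSeries = geomSeries ^ 2 := by
  have h := congrArg (d⁄dX ℝ) geomSeries_mul_one_sub_X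
  rw [Derivation.leibniz, map_sub, derivative_X, derivative_one, smul_eq_mul, smul_eq_mul] at h
  have h' := geomSeries_mul_one_sub_X
  linear_combination geomSeries * h - (d⁄dX ℝ geomSeries) * h'

theorem derivative_logSeries : d⁄dX ℝ logSeries = geomSeries := by
  ext n
  rw [coeff_derivative, logSeries, geomSeries, coeff_mk, coeff_mk]
  push_cast
  exact inv_mul_cancel₀ (by positivity)

/-- The power series of `L(u) ^ i * (1 - u) ^ (-j)`. -/
noncomputable def logGeom (i j : ℕ) : ℝ⟦X⟧ := logSeries ^ i * geomSeries ^ j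

theorem logGeom_mul (i j i' j' : ℕ) :
    logGeom i j * logGeom i' j' = logGeom (i + i') (j + j') := by
  simp only [logGeom, pow_add]
  ring

theorem derivative_logGeom_zero (j : ℕ) :
    d⁄dX ℝ (logGeom 0 j) = (j : ℝ) • logGeom 0 (j + 1) := by
  rcases j with _ | j
  · simp [logGeom]
  · simp only [logGeom, pow_zero, one_mul, derivative_pow, derivative_geomSeries,
      PowerSeries.smul_eq_C_mul, Nat.add_sub_cancel]
    simp
    ring

theorem derivative_logGeom_succ (i j : ℕ) :
    d⁄dX ℝ (logGeom (i + 1) j) =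
      ((i : ℝ) + 1) • logGeom i (j + 1) + (j : ℝ) • logGeom (i + 1) (j + 1) := by
  have h : logGeom (i + 1) j = logSeries ^ (i + 1) * logGeom 0 j := by simp [logGeom]
  rw [h, Derivation.leibniz, derivative_logGeom_zero, derivative_pow, derivative_logSeries]
  simp only [logGeom, PowerSeries.smul_eq_C_mul, smul_eq_mul, Nat.add_sub_cancel]
  simp
  ring

theorem derivative_logGeom (i j : ℕ) :
    d⁄dX ℝ (logGeom i j) =
      (i : ℝ) • logGeom (i - 1) (j + 1) + (j : ℝ) • logGeom i (j + 1) := by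
  rcases i with _ | i
  · simp [derivative_logGeom_zero]
  · simp [derivative_logGeom_succ]

/-- The span of the series `L ^ i * (1 - u) ^ (-j)` with `d ≤ j` and `(j, i)` lexicographically
below `(m, p)`. -/
noncomputable def lowSpan (d m p : ℕ) : Submodule ℝ ℝ⟦X⟧ :=
  Submodule.span ℝ {f | ∃ i j : ℕ, d ≤ j ∧ (j < m ∨ j = m ∧ i < p) ∧ f = logGeom i j}

theorem logGeom_mem_lowSpan {d m p i j : ℕ} (hd : d ≤ j) (h : j < m ∨ j = m ∧ i < p) :
    logGeom i j ∈ lowSpan d m p :=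
  Submodule.subset_span ⟨i, j, hd, h, rfl⟩

theorem lowSpan_le {d m p : ℕ} {N : Submodule ℝ ℝ⟦X⟧}
    (h : ∀ i j, d ≤ j → (j < m ∨ j = m ∧ i < p) → logGeom i j ∈ N) : lowSpan d m p ≤ N := by
  refine Submodule.span_le.2 ?_
  rintro _ ⟨i, j, hd, hj, rfl⟩
  exact h i j hd hj

theorem lowSpan_mono {d m p m' p' : ℕ} (h : m < m' ∨ m = m' ∧ p ≤ p') :
    lowSpan d m p ≤ lowSpan d m' p' :=
  lowSpan_le fun _ _ hd hj => logGeom_mem_lowSpan hd (by omega)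

/-- At the top pole order the strict bounds `i < p` and `i' < p'` give `i + i' ≤ p + p' - 2 < q`; at
lower pole orders the power of the logarithm is unrestricted. -/
theorem mul_mem_lowSpan {d m p d' m' p' q : ℕ} (hq : p + p' ≤ q + 1) {f g : ℝ⟦X⟧}
    (hf : f ∈ lowSpan d m p) (hg : g ∈ lowSpan d' m' p') :
    f * g ∈ lowSpan (d + d') (m + m') q := by
  refine Submodule.span_induction₂ (p := fun f g _ _ => f * g ∈ lowSpan (d + d') (m + m') q)
    ?_ (fun _ _ => by simp) (fun _ _ => by simp) ?_ ?_ ?_ ?_ hf hg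
  · rintro _ _ ⟨i, j, hd, hj, rfl⟩ ⟨i', j', hd', hj', rfl⟩
    rw [logGeom_mul]
    exact logGeom_mem_lowSpan (by omega) (by omega)
  · intro x y z _ _ _ hx hy
    rw [add_mul]
    exact add_mem hx hy
  · intro x y z _ _ _ hx hy
    rw [mul_add]
    exact add_mem hx hy
  · intro r x y _ _ h
    rw [smul_mul_assoc]
    exact Submodule.smul_mem _ _ h
  · intro r x y _ _ h
    rw [mul_smul_comm]
    exact Submodule.smul_mem _ _ h

/-- The operator multiplying the `n`-th coefficient by `n.choose j`. -/
noncomputable def chooseOp (j : ℕ) (f : ℝ⟦X⟧) : ℝ⟦X⟧ :=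
  PowerSeries.mk fun n => (n.choose j : ℝ) * coeff n f

theorem coeff_X_mul_derivative (f : ℝ⟦X⟧) (n : ℕ) : coeff n (X * d⁄dX ℝ f) = n * coeff n f := by
  rcases n with _ | n
  · simp
  · rw [coeff_succ_X_mul, coeff_derivative]
    push_cast
    ring

theorem chooseOp_zero (f : ℝ⟦X⟧) : chooseOp 0 f = f := by
  ext n
  simp [chooseOp]

/-- This is `(j+1) C(n,j+1) = (n-j) C(n,j)`, with multiplication by `n` realised as `X d/dX`. Each
such step raises the pole order by at most one and leaves the power of the logarithm alone. -/
theorem chooseOp_succ (j : ℕ) (f : ℝ⟦X⟧) : chooseOp (j + 1) f =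
    ((j : ℝ) + 1)⁻¹ • (X * d⁄dX ℝ (chooseOp j f) - (j : ℝ) • chooseOp j f) := by
  ext n
  rw [map_smul, map_sub, coeff_X_mul_derivative, map_smul]
  simp only [chooseOp, coeff_mk, smul_eq_mul]
  have h : ((n.choose (j + 1) : ℝ)) * (j + 1) = n.choose j * ((n : ℝ) - j) := by
    rcases le_or_gt j n with hjn | hjn
    · have := Nat.choose_succ_right_eq n j
      rw [← Nat.cast_sub hjn]
      exact_mod_cast this
    · rw [Nat.choose_eq_zero_of_lt hjn, Nat.choose_eq_zero_of_lt (by omega)]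
      simp
  field_simp
  linear_combination (coeff n f) * h

theorem chooseOp_one (f : ℝ⟦X⟧) : chooseOp 1 f = X * d⁄dX ℝ f := by
  ext n
  rw [coeff_X_mul_derivative, chooseOp, coeff_mk, Nat.choose_one_right]

theorem X_mul_derivative_logGeom (i j : ℕ) :
    X * d⁄dX ℝ (logGeom i j) =
      ((i : ℝ) • logGeom (i - 1) (j + 1) + (j : ℝ) • logGeom i (j + 1)) -
        ((i : ℝ) • logGeom (i - 1) j + (j : ℝ) • logGeom i j) := by
  rw [derivative_logGeom]
  simp only [logGeom, PowerSeries.smul_eq_C_mul]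
  have h := X_mul_geomSeries_pow_succ j
  linear_combination (C (i : ℝ) * logSeries ^ (i - 1) + C (j : ℝ) * logSeries ^ i) * h

theorem X_mul_derivative_mem_lowSpan {d m p : ℕ} {f : ℝ⟦X⟧} (hf : f ∈ lowSpan d m p) :
    X * d⁄dX ℝ f ∈ lowSpan d (m + 1) p := by
  refine Submodule.span_induction ?_ (by simp) ?_ ?_ hf
  · rintro _ ⟨i, j, hd, hj, rfl⟩
    rw [X_mul_derivative_logGeom]
    refine sub_mem (add_mem ?_ ?_) (add_mem ?_ ?_) <;>
      exact Submodule.smul_mem _ _ (logGeom_mem_lowSpan (by omega) (by omega))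
  · intro x y _ _ hx hy
    rw [map_add, mul_add]
    exact add_mem hx hy
  · intro r x _ hx
    rw [Derivation.map_smul, mul_smul_comm]
    exact Submodule.smul_mem _ _ hx

theorem chooseOp_mem_lowSpan {d m p : ℕ} {f : ℝ⟦X⟧} (hf : f ∈ lowSpan d m p) (j : ℕ) :
    chooseOp j f ∈ lowSpan d (m + j) p := by
  induction j with
  | zero => rwa [chooseOp_zero]
  | succ j ih =>
    rw [chooseOp_succ]
    refine Submodule.smul_mem _ _ (sub_mem (X_mul_derivative_mem_lowSpan ih)
      (Submodule.smul_mem _ _ (lowSpan_mono (by omega) ih)))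

/-- `f = α L ^ (p + 1) (1 - u) ^ (-m) + β L ^ p (1 - u) ^ (-m)` up to terms of lower order. -/
def HasTop (d m p : ℕ) (α β : ℝ) (f : ℝ⟦X⟧) : Prop :=
  f - (α • logGeom (p + 1) m + β • logGeom p m) ∈ lowSpan d m p

theorem hasTop_logGeom (d m p : ℕ) (α β : ℝ) :
    HasTop d m p α β (α • logGeom (p + 1) m + β • logGeom p m) := by
  simp [HasTop]

theorem hasTop_of_mem {d m p : ℕ} {f : ℝ⟦X⟧} (hf : f ∈ lowSpan d m p) : HasTop d m p 0 0 f := by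
  simpa [HasTop] using hf

theorem HasTop.add {d m p : ℕ} {α β α' β' : ℝ} {f g : ℝ⟦X⟧} (hf : HasTop d m p α β f)
    (hg : HasTop d m p α' β' g) : HasTop d m p (α + α') (β + β') (f + g) := by
  have h := add_mem hf hg
  unfold HasTop
  convert h using 1
  rw [add_smul, add_smul]
  abel

theorem HasTop.sum {ι : Type*} {d m p : ℕ} {s : Finset ι} {α β : ι → ℝ} {f : ι → ℝ⟦X⟧}
    (h : ∀ i ∈ s, HasTop d m p (α i) (β i) (f i)) :
    HasTop d m p (∑ i ∈ s, α i) (∑ i ∈ s, β i) (∑ i ∈ s, f i) := by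
  classical
  induction s using Finset.induction_on with
  | empty => exact hasTop_of_mem (by simp)
  | insert a s ha ih =>
    rw [Finset.sum_insert ha, Finset.sum_insert ha, Finset.sum_insert ha]
    exact (h a (Finset.mem_insert_self _ _)).add
      (ih fun i hi => h i (Finset.mem_insert_of_mem hi))

theorem HasTop.mem {d m p : ℕ} {α β : ℝ} {f : ℝ⟦X⟧} (hf : HasTop d m p α β f) (hd : d ≤ m) :
    f ∈ lowSpan d m (p + 2) := by
  have h := add_mem (lowSpan_mono (Or.inr ⟨rfl, by omega⟩) hf :
    _ ∈ lowSpan d m (p + 2)) (add_mem (Submodule.smul_mem _ α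
      (logGeom_mem_lowSpan (d := d) (m := m) (p := p + 2) (i := p + 1) hd (by omega)))
      (Submodule.smul_mem _ β (logGeom_mem_lowSpan (i := p) hd (by omega))))
  simpa using h

/-- The product of the two second terms has logarithmic power `p + p'`, already below the two
leading powers, so `β * β'` enters only the remainder. -/
theorem HasTop.mul {d m p d' m' p' : ℕ} {α β α' β' : ℝ} {f g : ℝ⟦X⟧} (hd : d ≤ m)
    (hd' : d' ≤ m') (hf : HasTop d m p α β f) (hg : HasTop d' m' p' α' β' g) :
    HasTop (d + d') (m + m') (p + p' + 1) (α * α') (α * β' + β * α') (f * g) := by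
  have h1 := mul_mem_lowSpan (q := p + p' + 1) (by omega) hf (hg.mem hd')
  have h2 := mul_mem_lowSpan (q := p + p' + 1) (by omega)
    ((hasTop_logGeom d m p α β).mem hd) hg
  have h3 := Submodule.smul_mem _ (β * β') (logGeom_mem_lowSpan (d := d + d') (m := m + m')
    (p := p + p' + 1) (i := p + p') (j := m + m') (by omega) (by omega))
  have h := add_mem (add_mem h1 h2) h3
  unfold HasTop
  convert h using 1
  have e1 : logGeom (p + p' + 1 + 1) (m + m') = logGeom (p + 1) m * logGeom (p' + 1) m' := by
    rw [logGeom_mul]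
    congr 1
    omega
  have e2 : logGeom (p + p' + 1) (m + m') = logGeom (p + 1) m * logGeom p' m' := by
    rw [logGeom_mul]
    congr 1
    omega
  have e2' : logGeom (p + 1) m * logGeom p' m' = logGeom p m * logGeom (p' + 1) m' := by
    rw [logGeom_mul, logGeom_mul]
    congr 1
    omega
  have e3 : logGeom (p + p') (m + m') = logGeom p m * logGeom p' m' := by
    rw [logGeom_mul]
  rw [e1, e2, e3]
  simp only [PowerSeries.smul_eq_C_mul, map_add, map_mul]
  linear_combination (-C β * C α') * e2'

theorem HasTop.mul_geomSeries {d m p : ℕ} {α β : ℝ} {f : ℝ⟦X⟧} (hf : HasTop d m p α β f) :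
    HasTop (d + 1) (m + 1) p α β (f * geomSeries) := by
  have hy : geomSeries = logGeom 0 1 := by simp [logGeom]
  have h := mul_mem_lowSpan (q := p) (by omega) hf
    (logGeom_mem_lowSpan (d := 1) (m := 1) (p := 1) (i := 0) (j := 1) le_rfl (by omega))
  unfold HasTop
  convert h using 1
  rw [sub_mul, add_mul, smul_mul_assoc, smul_mul_assoc, logGeom_mul, logGeom_mul, ← hy]
  simp

/-- Differentiating the pole gives the factor `m`; differentiating `L^(p+1)` costs one logarithm and
adds `(p+1) * α` to the second coefficient. The factor `X` only changes lower pole orders. -/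
theorem HasTop.X_mul_derivative {d m p : ℕ} {α β : ℝ} {f : ℝ⟦X⟧} (hd : d ≤ m)
    (hf : HasTop d m p α β f) :
    HasTop d (m + 1) p (m * α) (m * β + (p + 1) * α) (X * d⁄dX ℝ f) := by
  have h1 := X_mul_derivative_mem_lowSpan hf
  have h2 : ∀ i, logGeom i m ∈ lowSpan d (m + 1) p := fun i => logGeom_mem_lowSpan hd (by omega)
  have h3 : (p : ℝ) • logGeom (p - 1) (m + 1) ∈ lowSpan d (m + 1) p := by
    rcases p with _ | p
    · simp
    · exact Submodule.smul_mem _ _ (logGeom_mem_lowSpan (by omega) (by omega))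
  have h := sub_mem (add_mem h1 (Submodule.smul_mem _ β h3))
    (add_mem (add_mem (Submodule.smul_mem _ (α * (p + 1)) (h2 p))
      (Submodule.smul_mem _ (α * m) (h2 (p + 1))))
      (add_mem (Submodule.smul_mem _ (β * p) (h2 (p - 1))) (Submodule.smul_mem _ (β * m) (h2 p))))
  unfold HasTop
  convert h using 1
  rw [map_sub, map_add, Derivation.map_smul, Derivation.map_smul, mul_sub, mul_add,
    mul_smul_comm, mul_smul_comm, X_mul_derivative_logGeom, X_mul_derivative_logGeom]
  simp only [PowerSeries.smul_eq_C_mul, map_add, map_mul, Nat.add_sub_cancel]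
  push_cast
  simp only [map_add, map_one]
  ring

/-- Particular solutions of `f' = 2 f / (1 - u) + h`. -/
theorem exists_solution_logGeom {m p i k : ℕ} (hm : 3 ≤ m) (hk : 1 ≤ k)
    (h : k < m ∨ k = m ∧ i < p) :
    ∃ f ∈ lowSpan 1 m p, d⁄dX ℝ f = 2 * geomSeries * f + logGeom i (k + 1) := by
  -- Resonance: `(1-u)^{-2}` solves the homogeneous equation, so for `k = 2` the solution gains a
  -- logarithm. This is still of lower order because `3 ≤ m`.
  by_cases hk2 : k = 2
  · subst hk2
    refine ⟨((i : ℝ) + 1)⁻¹ • logGeom (i + 1) 2,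
      Submodule.smul_mem _ _ (logGeom_mem_lowSpan (by omega) (by omega)), ?_⟩
    rw [Derivation.map_smul, derivative_logGeom_succ, smul_add, smul_smul,
      inv_mul_cancel₀ (by positivity), one_smul]
    have h2 : (C (((2 : ℕ) : ℝ)) : ℝ⟦X⟧) = 2 := map_ofNat C 2
    simp only [logGeom, PowerSeries.smul_eq_C_mul, h2]
    ring
  · have hk0 : (k : ℝ) - 2 ≠ 0 := by
      rw [sub_ne_zero]
      exact_mod_cast hk2
    have hC : (C ((k : ℝ) - 2)⁻¹ : ℝ⟦X⟧) * (C (k : ℝ) - 2) = 1 := by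
      have : (C (k : ℝ) - 2 : ℝ⟦X⟧) = C ((k : ℝ) - 2) := by
        rw [map_sub, map_ofNat]
      rw [this, ← map_mul, inv_mul_cancel₀ hk0, map_one]
    -- Off resonance, `L^i (1-u)^{-k} / (k-2)` solves the equation up to a term with one logarithm
    -- less, which is removed by induction.
    induction i with
    | zero =>
      refine ⟨((k : ℝ) - 2)⁻¹ • logGeom 0 k,
        Submodule.smul_mem _ _ (logGeom_mem_lowSpan (by omega) (by omega)), ?_⟩
      rw [Derivation.map_smul, derivative_logGeom_zero]
      simp only [logGeom, PowerSeries.smul_eq_C_mul]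
      linear_combination (logSeries ^ 0 * geomSeries ^ (k + 1)) * hC
    | succ i ih =>
      obtain ⟨g, hg, hg'⟩ := ih (by omega)
      refine ⟨((k : ℝ) - 2)⁻¹ • (logGeom (i + 1) k - ((i : ℝ) + 1) • g),
        Submodule.smul_mem _ _ (sub_mem (logGeom_mem_lowSpan (by omega) (by omega))
          (Submodule.smul_mem _ _ hg)), ?_⟩
      rw [Derivation.map_smul, map_sub, Derivation.map_smul, hg', derivative_logGeom_succ]
      simp only [logGeom, PowerSeries.smul_eq_C_mul]
      linear_combination (logSeries ^ (i + 1) * geomSeries ^ (k + 1)) * hC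

theorem exists_solution_of_mem {m p : ℕ} (hm : 3 ≤ m) {h : ℝ⟦X⟧}
    (hh : h ∈ lowSpan 2 (m + 1) p) :
    ∃ f ∈ lowSpan 1 m p, d⁄dX ℝ f = 2 * geomSeries * f + h := by
  refine Submodule.span_induction ?_ ⟨0, by simp, by simp⟩ ?_ ?_ hh
  · rintro _ ⟨i, j, hd, hj, rfl⟩
    obtain ⟨k, rfl⟩ : ∃ k, j = k + 1 := ⟨j - 1, by omega⟩
    exact exists_solution_logGeom hm (by omega) (by omega)
  · rintro x y _ _ ⟨f, hf, hf'⟩ ⟨g, hg, hg'⟩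
    refine ⟨f + g, add_mem hf hg, ?_⟩
    rw [map_add, hf', hg']
    ring
  · rintro r x _ ⟨f, hf, hf'⟩
    refine ⟨r • f, Submodule.smul_mem _ _ hf, ?_⟩
    rw [Derivation.map_smul, hf', smul_add, mul_smul_comm]

/-- `(1-u)^2` is an integrating factor: `(f - g)(1-u)^2` has zero derivative and zero constant term.
-/
theorem eq_of_derivative_eq {f g h : ℝ⟦X⟧} (hf : d⁄dX ℝ f = 2 * geomSeries * f + h)
    (hg : d⁄dX ℝ g = 2 * geomSeries * g + h)
    (h0 : constantCoeff f = constantCoeff g) : f = g := by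
  have hy := geomSeries_mul_one_sub_X
  have key : f * (1 - X) ^ 2 = g * (1 - X) ^ 2 := by
    refine derivative.ext ?_ (by simp [h0])
    rw [Derivation.leibniz, Derivation.leibniz, hf, hg, derivative_pow, map_sub, derivative_X,
      derivative_one]
    simp only [smul_eq_mul]
    push_cast
    linear_combination (2 * (1 - X) * (f - g)) * hy
  have e : ∀ a : ℝ⟦X⟧, a = a * (1 - X) ^ 2 * geomSeries ^ 2 := fun a => by
    linear_combination (-a * (1 + geomSeries * (1 - X))) * hy
  rw [e f, key, ← e g]

/-- Solutions of `f' = 2 f / (1 - u) + h` inherit the two leading terms of `h`. -/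
theorem HasTop.of_derivative {m p : ℕ} (hm : 3 ≤ m) {α β : ℝ} {f h : ℝ⟦X⟧}
    (hh : HasTop 2 (m + 1) p (((m : ℝ) - 2) * α) ((p + 1) * α + ((m : ℝ) - 2) * β) h)
    (hf : d⁄dX ℝ f = 2 * geomSeries * f + h) : HasTop 1 m p α β f := by
  have h3 : (p : ℝ) • logGeom (p - 1) (m + 1) ∈ lowSpan 2 (m + 1) p := by
    rcases p with _ | p
    · simp
    · exact Submodule.smul_mem _ _ (logGeom_mem_lowSpan (by omega) (by omega))
  -- The proposed leading part solves the equation except for the term `β p L^(p-1)` and the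
  -- remainder of `h`; `g` corrects both, and a multiple of `(1-u)^{-2}` fixes the constant term.
  obtain ⟨g, hg, hg'⟩ := exists_solution_of_mem hm (p := p) (sub_mem hh (Submodule.smul_mem _ β h3))
  set g0 : ℝ⟦X⟧ := α • logGeom (p + 1) m + β • logGeom p m with hg0
  set c : ℝ := constantCoeff f - constantCoeff (g0 + g)
  have hfg : f = g0 + g + c • logGeom 0 2 := by
    refine eq_of_derivative_eq hf ?_ ?_
    · rw [map_add, map_add, hg', Derivation.map_smul, derivative_logGeom_zero, hg0, map_add,
        Derivation.map_smul, Derivation.map_smul, derivative_logGeom, derivative_logGeom]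
      simp only [logGeom, PowerSeries.smul_eq_C_mul, map_add, map_mul, map_sub, Nat.add_sub_cancel]
      push_cast
      simp only [map_add, map_one]
      have : (C (2 : ℝ) : ℝ⟦X⟧) = 2 := map_ofNat C 2
      rw [this]
      ring
    · have : constantCoeff (c • logGeom 0 2) = c := by
        simp [logGeom, geomSeries, PowerSeries.smul_eq_C_mul]
      rw [map_add, this]
      simp [c]
  have h' : g + c • logGeom 0 2 ∈ lowSpan 1 m p :=
    add_mem hg (Submodule.smul_mem _ _ (logGeom_mem_lowSpan (by omega) (by omega)))
  unfold HasTop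
  convert h' using 1
  rw [hfg, ← hg0]
  abel

end LogSeries

/-! ### The two leading terms of the moment generating functions. -/

section MomentSeries

open PowerSeries Finset.HasAntidiagonal

/-- The generating function of the `s`-th binomial moments. -/
noncomputable def momentSeries (s : ℕ) : ℝ⟦X⟧ := PowerSeries.mk (binomialMoment s)

/-- The generating function of the shifted moments. -/
noncomputable def shiftedSeries (a : ℕ) : ℝ⟦X⟧ := PowerSeries.mk (shiftedMoment a)

/-- The part of `shiftedSeries (p + 1)` that comes from the moments of order at most `p`. -/
noncomputable def lowerShift (p : ℕ) : ℝ⟦X⟧ :=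
  ∑ q ∈ antidiagonal p, chooseOp (q.1 + 1) (momentSeries q.2)

theorem shiftedSeries_eq_sum (a : ℕ) :
    shiftedSeries a = ∑ p ∈ antidiagonal a, chooseOp p.1 (momentSeries p.2) := by
  ext n
  simp [shiftedSeries, shiftedMoment, chooseOp, momentSeries]

theorem shiftedSeries_succ (p : ℕ) :
    shiftedSeries (p + 1) = momentSeries (p + 1) + lowerShift p := by
  rw [shiftedSeries_eq_sum, Finset.Nat.sum_antidiagonal_succ, chooseOp_zero, lowerShift]

theorem derivative_momentSeries (s : ℕ) : d⁄dX ℝ (momentSeries s) =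
    ∑ q ∈ antidiagonal s, shiftedSeries q.1 * shiftedSeries q.2 := by
  ext n
  rw [coeff_derivative, momentSeries, coeff_mk, mul_comm, binomialMoment_recursion, map_sum]
  refine Finset.sum_congr rfl fun q _ => ?_
  rw [coeff_mul]
  simp [shiftedSeries]

theorem momentSeries_zero : momentSeries 0 = geomSeries := by
  ext n
  simp [momentSeries, geomSeries, binomialMoment_zero_left]

theorem shiftedSeries_zero : shiftedSeries 0 = geomSeries := by
  rw [shiftedSeries_eq_sum]
  simp [chooseOp_zero, momentSeries_zero]

theorem constantCoeff_momentSeries_succ (s : ℕ) : constantCoeff (momentSeries (s + 1)) = 0 := by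
  rw [← coeff_zero_eq_constantCoeff_apply, momentSeries, coeff_mk, binomialMoment_zero_right]
  simp

theorem logGeom_zero_one : logGeom 0 1 = geomSeries := by simp [logGeom]

theorem lowerShift_zero : lowerShift 0 = geomSeries ^ 2 - geomSeries := by
  have h := X_mul_geomSeries_pow_succ 1
  simp [lowerShift, chooseOp_one, momentSeries_zero, derivative_geomSeries, h]

/-- The case `s = 1` is solved exactly: its top pole order is the resonant `2`, which
`HasTop.of_derivative` excludes. -/
theorem momentSeries_one : momentSeries 1 =
    (2 : ℝ) • logGeom 1 2 - (2 : ℝ) • logGeom 0 2 + (2 : ℝ) • logGeom 0 1 := by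
  refine eq_of_derivative_eq (h := 2 * geomSeries * lowerShift 0) ?_ ?_ ?_
  · rw [derivative_momentSeries, Finset.Nat.sum_antidiagonal_succ]
    simp only [antidiagonal_zero, Finset.sum_singleton, zero_add, shiftedSeries_zero,
      shiftedSeries_succ]
    ring
  · rw [lowerShift_zero, map_add, map_sub, Derivation.map_smul, Derivation.map_smul,
      Derivation.map_smul, derivative_logGeom, derivative_logGeom, derivative_logGeom]
    have h2 : (C (2 : ℝ) : ℝ⟦X⟧) = 2 := map_ofNat C 2
    simp only [logGeom, PowerSeries.smul_eq_C_mul, h2, Nat.cast_zero, Nat.cast_one,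
      Nat.cast_ofNat, map_zero, map_one]
    ring
  · rw [constantCoeff_momentSeries_succ 0]
    simp [logGeom, logSeries, geomSeries, PowerSeries.smul_eq_C_mul]

/-- Seen from one logarithm higher, the leading coefficient becomes the second one and `β` drops
into the remainder. -/
theorem HasTop.raise {d m p : ℕ} {α β : ℝ} {f : ℝ⟦X⟧} (hd : d ≤ m) (hf : HasTop d m p α β f) :
    HasTop d m (p + 1) 0 α f := by
  have h := add_mem (lowSpan_mono (Or.inr ⟨rfl, p.le_succ⟩) hf : _ ∈ lowSpan d m (p + 1))
    (Submodule.smul_mem _ β (logGeom_mem_lowSpan (i := p) hd (by omega)))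
  unfold HasTop
  convert h using 1
  rw [zero_smul]
  abel

/-- The second leading coefficient of the generating function of the binomial moments. -/
noncomputable def secondCoeff (s : ℕ) : ℝ := 2 ^ s * s * ((harmonic s : ℝ) - 2)

theorem momentSeries_mem_lowSpan {b : ℕ} (h : b = 0 ∨ ∃ p, b = p + 1 ∧
    HasTop 1 (p + 2) p (2 ^ (p + 1)) (secondCoeff (p + 1)) (momentSeries (p + 1))) :
    momentSeries b ∈ lowSpan 1 (b + 1) (b + 1) := by
  rcases h with rfl | ⟨p, rfl, h⟩
  · rw [momentSeries_zero, ← logGeom_zero_one]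
    exact logGeom_mem_lowSpan (by omega) (by omega)
  · exact h.mem (by omega)

/-- The summand built from the moment series of order `b` has pole order `p + 2` but at most `b`
logarithms. Only `b = p`, that is `u F_p'`, reaches `L^p`, with coefficient `(p+1) * 2^p`. -/
theorem hasTop_lowerShift {p : ℕ} (h : ∀ b < p,
    HasTop 1 (b + 2) b (2 ^ (b + 1)) (secondCoeff (b + 1)) (momentSeries (b + 1))) :
    HasTop 1 (p + 2) p 0 ((p + 1) * 2 ^ p) (lowerShift p) := by
  rcases p with _ | p
  · rw [lowerShift_zero]
    have h1 : -logGeom 0 1 ∈ lowSpan 1 2 0 := neg_mem (logGeom_mem_lowSpan (by omega) (by omega))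
    unfold HasTop
    convert h1 using 1
    simp [logGeom]
  · have h1 : HasTop 1 (p + 3) (p + 1) 0 (((p + 1 : ℕ) + 1) * 2 ^ (p + 1))
        (chooseOp 1 (momentSeries (p + 1))) := by
      rw [chooseOp_one]
      have h2 := ((h p (by omega)).X_mul_derivative (by omega)).raise (by omega)
      convert h2 using 1
      push_cast
      ring
    have h2 : ∑ q ∈ antidiagonal p, chooseOp (q.1 + 2) (momentSeries q.2) ∈
        lowSpan 1 (p + 3) (p + 1) := by
      refine Submodule.sum_mem _ fun q hq => ?_
      rw [mem_antidiagonal] at hq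
      have h3 : momentSeries q.2 ∈ lowSpan 1 (q.2 + 1) (q.2 + 1) := by
        refine momentSeries_mem_lowSpan ?_
        rcases hb : q.2 with _ | b
        · exact Or.inl rfl
        · exact Or.inr ⟨b, rfl, h b (by omega)⟩
      exact lowSpan_mono (by omega) (chooseOp_mem_lowSpan h3 (q.1 + 2))
    have h3 := h1.add (hasTop_of_mem h2)
    rw [add_zero, add_zero] at h3
    rwa [lowerShift, Finset.Nat.sum_antidiagonal_succ]

/-- The recursion for the second coefficient. The `3/2` is the `2` of `secondCoeff` less the `1/2`
contributed by `lowerShift`. -/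
theorem sum_mul_harmonic (p : ℕ) :
    ∑ j ∈ Finset.range (p + 1), 2 * ((j : ℝ) + 1) * ((harmonic (j + 1) : ℝ) - 3 / 2) =
      (p + 1) * (p + 2) * ((harmonic (p + 2) : ℝ) - 2) := by
  induction p with
  | zero =>
    simp [harmonic, Finset.sum_range_succ]
    norm_num
  | succ p ih =>
    rw [Finset.sum_range_succ, ih, harmonic_succ (p + 2)]
    push_cast
    field_simp
    ring

/-- The two leading terms of the generating function of the binomial moments. -/
theorem hasTop_momentSeries (p : ℕ) :
    HasTop 1 (p + 2) p (2 ^ (p + 1)) (secondCoeff (p + 1)) (momentSeries (p + 1)) := by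
  induction p using Nat.strong_induction_on with
  | _ p ih =>
  rcases p with _ | p
  · have h1 : (2 : ℝ) • logGeom 0 1 ∈ lowSpan 1 2 0 :=
      Submodule.smul_mem _ _ (logGeom_mem_lowSpan (by omega) (by omega))
    unfold HasTop
    convert h1 using 1
    have : secondCoeff (0 + 1) = -2 := by
      simp [secondCoeff, harmonic]
      norm_num
    rw [this, momentSeries_one, neg_smul]
    simp only [zero_add, pow_one]
    abel
  -- The two extreme products each contain the unknown series once, times `1/(1-u)`; all the rest is
  -- covered by the induction hypothesis.
  · have hder : d⁄dX ℝ (momentSeries (p + 1 + 1)) = 2 * geomSeries * momentSeries (p + 1 + 1) +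
        ((lowerShift (p + 1) + lowerShift (p + 1)) * geomSeries +
          ∑ q ∈ antidiagonal p, shiftedSeries (q.1 + 1) * shiftedSeries (q.2 + 1)) := by
      rw [derivative_momentSeries, Finset.Nat.sum_antidiagonal_succ,
        Finset.Nat.sum_antidiagonal_succ']
      simp only [shiftedSeries_zero]
      rw [shiftedSeries_succ (p + 1)]
      ring
    refine HasTop.of_derivative (by omega) ?_ hder
    have hE : HasTop 1 (p + 1 + 2) (p + 1) 0 (((p + 1 : ℕ) + 1) * 2 ^ (p + 1))
        (lowerShift (p + 1)) := hasTop_lowerShift ih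
    have hD : ∀ i ≤ p, HasTop 1 (i + 2) i (2 ^ (i + 1))
        (secondCoeff (i + 1) + (i + 1) * 2 ^ i) (shiftedSeries (i + 1)) := by
      intro i hi
      rw [shiftedSeries_succ]
      have h := (ih i (by omega)).add (hasTop_lowerShift fun b hb => ih b (by omega))
      rwa [add_zero] at h
    have hprod : ∀ q ∈ antidiagonal p, HasTop 2 (p + 4) (p + 1) (2 ^ (p + 2))
        (2 ^ (p + 2) * (((q.1 : ℝ) + 1) * ((harmonic (q.1 + 1) : ℝ) - 3 / 2)) +
          2 ^ (p + 2) * (((q.2 : ℝ) + 1) * ((harmonic (q.2 + 1) : ℝ) - 3 / 2)))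
        (shiftedSeries (q.1 + 1) * shiftedSeries (q.2 + 1)) := by
      rintro ⟨i, j⟩ hq
      rw [mem_antidiagonal] at hq
      dsimp only at hq ⊢
      subst hq
      have h := (hD i (by omega)).mul (by omega) (by omega) (hD j (by omega))
      rw [show i + 2 + (j + 2) = i + j + 4 by ring] at h
      convert h using 1
      · ring
      · simp only [secondCoeff]
        push_cast
        ring
    have h := (hE.add hE).mul_geomSeries.add (HasTop.sum hprod)
    convert h using 1
    · simp only [Finset.sum_const, Finset.Nat.card_antidiagonal, nsmul_eq_mul]
      push_cast
      ring
    -- The `lowerShift` terms contribute `2 * (p+2) * 2^(p+1)`, which cancels the `(p+2) * α`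
    -- demanded by `HasTop.of_derivative`; what remains is the harmonic identity.
    · have hs := sum_mul_harmonic p
      have hs1 := Finset.Nat.sum_antidiagonal_eq_sum_range_succ_mk
        (fun q : ℕ × ℕ => ((q.1 : ℝ) + 1) * ((harmonic (q.1 + 1) : ℝ) - 3 / 2)) p
      have hs2 := Finset.Nat.sum_antidiagonal_swap (n := p)
        (f := fun q : ℕ × ℕ => ((q.1 : ℝ) + 1) * ((harmonic (q.1 + 1) : ℝ) - 3 / 2))
      simp only [Prod.fst_swap] at hs2
      simp only [mul_assoc, ← Finset.mul_sum] at hs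
      rw [Finset.sum_add_distrib, ← Finset.mul_sum, ← Finset.mul_sum, hs2, hs1]
      simp only [secondCoeff]
      push_cast
      linear_combination (-2 ^ (p + 2)) * hs

end MomentSeries

/-! ### From formal series to functions on the unit disc. -/

section Evaluation

open PowerSeries

/-- The power series `f` converges absolutely at `u`, with sum `v`. -/
def HasAbsSum (f : ℝ⟦X⟧) (u v : ℂ) : Prop :=
  Summable (fun n => ‖((coeff n f : ℝ) : ℂ) * u ^ n‖) ∧
    HasSum (fun n => ((coeff n f : ℝ) : ℂ) * u ^ n) v

theorem HasAbsSum.add {f g : ℝ⟦X⟧} {u v w : ℂ} (hf : HasAbsSum f u v) (hg : HasAbsSum g u w) :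
    HasAbsSum (f + g) u (v + w) := by
  have e : (fun n => ((coeff n (f + g) : ℝ) : ℂ) * u ^ n) =
      fun n => ((coeff n f : ℝ) : ℂ) * u ^ n + ((coeff n g : ℝ) : ℂ) * u ^ n := by
    funext n
    rw [map_add]
    push_cast
    ring
  refine ⟨?_, e ▸ hf.2.add hg.2⟩
  refine Summable.of_nonneg_of_le (fun _ => norm_nonneg _) (fun n => ?_) (hf.1.add hg.1)
  rw [congrFun e n]
  exact norm_add_le _ _

theorem HasAbsSum.smul {f : ℝ⟦X⟧} {u v : ℂ} (r : ℝ) (hf : HasAbsSum f u v) :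
    HasAbsSum (r • f) u (r * v) := by
  have e : (fun n => ((coeff n (r • f) : ℝ) : ℂ) * u ^ n) =
      fun n => (r : ℂ) * (((coeff n f : ℝ) : ℂ) * u ^ n) := by
    funext n
    rw [map_smul, smul_eq_mul]
    push_cast
    ring
  refine ⟨?_, e ▸ hf.2.mul_left (r : ℂ)⟩
  have h := hf.1.mul_left ‖(r : ℂ)‖
  simp only [← norm_mul] at h
  simpa only [congrFun e] using h

theorem HasAbsSum.mul {f g : ℝ⟦X⟧} {u v w : ℂ} (hf : HasAbsSum f u v) (hg : HasAbsSum g u w) :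
    HasAbsSum (f * g) u (v * w) := by
  have e : (fun n => ((coeff n (f * g) : ℝ) : ℂ) * u ^ n) =
      fun n => ∑ p ∈ Finset.HasAntidiagonal.antidiagonal n,
        (((coeff p.1 f : ℝ) : ℂ) * u ^ p.1) * (((coeff p.2 g : ℝ) : ℂ) * u ^ p.2) := by
    funext n
    rw [coeff_mul]
    push_cast
    rw [Finset.sum_mul]
    refine Finset.sum_congr rfl fun p hp => ?_
    rw [← Finset.HasAntidiagonal.mem_antidiagonal.1 hp, pow_add]
    ring
  have hs := summable_norm_sum_mul_antidiagonal_of_summable_norm hf.1 hg.1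
  refine ⟨by simpa only [congrFun e] using hs, ?_⟩
  rw [e, ← hf.2.tsum_eq, ← hg.2.tsum_eq,
    tsum_mul_tsum_eq_tsum_sum_antidiagonal_of_summable_norm hf.1 hg.1]
  exact hs.of_norm.hasSum

theorem hasAbsSum_one (u : ℂ) : HasAbsSum 1 u 1 := by
  have h : ∀ n ≠ 0, ((coeff n (1 : ℝ⟦X⟧) : ℝ) : ℂ) * u ^ n = 0 := by
    intro n hn
    simp [coeff_one, hn]
  refine ⟨summable_of_ne_finset_zero (s := {0}) fun n hn => ?_, ?_⟩
  · rw [h n (by simpa using hn), norm_zero]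
  · simpa using hasSum_single 0 h

theorem HasAbsSum.pow {f : ℝ⟦X⟧} {u v : ℂ} (hf : HasAbsSum f u v) (k : ℕ) :
    HasAbsSum (f ^ k) u (v ^ k) := by
  induction k with
  | zero => simpa using hasAbsSum_one u
  | succ k ih =>
    rw [pow_succ, pow_succ]
    exact ih.mul hf

theorem hasAbsSum_geomSeries {u : ℂ} (hu : ‖u‖ < 1) : HasAbsSum geomSeries u (1 - u)⁻¹ := by
  have e : (fun n => ((coeff n geomSeries : ℝ) : ℂ) * u ^ n) = fun n => u ^ n := by
    funext n
    simp [geomSeries]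
  refine ⟨?_, e ▸ hasSum_geometric_of_norm_lt_one hu⟩
  simp only [congrFun e]
  exact summable_norm_geometric_of_norm_lt_one hu

theorem hasAbsSum_logSeries {u : ℂ} (hu : ‖u‖ < 1) : HasAbsSum logSeries u (logTerm u) := by
  have e : (fun n => ((coeff n logSeries : ℝ) : ℂ) * u ^ n) = fun n : ℕ => u ^ n / n := by
    funext n
    simp only [logSeries, coeff_mk]
    push_cast
    ring
  have hre : 0 < (1 - u).re := by
    have := Complex.re_le_norm u
    simp only [Complex.sub_re, Complex.one_re]
    linarith
  -- Since `1 - u` has positive real part, the principal logarithm commutes with inversion.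
  have hlog : logTerm u = -Complex.log (1 - u) := by
    rw [logTerm, one_div, Complex.log_inv]
    intro h
    rw [Complex.arg_eq_pi_iff] at h
    linarith [h.1]
  refine ⟨?_, ?_⟩
  · refine Summable.of_nonneg_of_le (fun _ => norm_nonneg _) (fun n => ?_)
      (summable_norm_geometric_of_norm_lt_one hu)
    rw [congrFun e n, norm_div, Complex.norm_natCast]
    rcases n with _ | n
    · simp
    · refine div_le_self (norm_nonneg _) ?_
      push_cast
      linarith [n.cast_nonneg (α := ℝ)]
  · rw [e, hlog]
    exact Complex.hasSum_taylorSeries_neg_log hu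

theorem hasAbsSum_logGeom (i j : ℕ) {u : ℂ} (hu : ‖u‖ < 1) :
    HasAbsSum (logGeom i j) u (logTerm u ^ i * (1 - u)⁻¹ ^ j) :=
  ((hasAbsSum_logSeries hu).pow i).mul ((hasAbsSum_geomSeries hu).pow j)

theorem IsLowerOrder.zero (p q : ℤ) : IsLowerOrder p q fun _ => 0 :=
  ⟨0, by simp, by simp⟩

theorem IsLowerOrder.add {p q : ℤ} {R S : ℂ → ℂ} (hR : IsLowerOrder p q R)
    (hS : IsLowerOrder p q S) : IsLowerOrder p q fun u => R u + S u := by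
  classical
  obtain ⟨c, hc, hc'⟩ := hR
  obtain ⟨d, hd, hd'⟩ := hS
  refine ⟨c + d, fun x hx => ?_, fun u hu => ?_⟩
  · rcases Finset.mem_union.1 (Finsupp.support_add hx) with h | h
    exacts [hc x h, hd x h]
  · beta_reduce
    rw [hc' u hu, hd' u hu]
    exact (Finsupp.sum_add_index' (h := fun (x : ℕ × ℤ) (a : ℝ) =>
      (a : ℂ) * (logTerm u ^ x.1 * (1 - u) ^ (-x.2 - 1))) (by simp)
      (fun x a b => by push_cast; ring)).symm

theorem IsLowerOrder.smul {p q : ℤ} {R : ℂ → ℂ} (r : ℝ) (hR : IsLowerOrder p q R) :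
    IsLowerOrder p q fun u => r * R u := by
  classical
  obtain ⟨c, hc, hc'⟩ := hR
  refine ⟨r • c, fun x hx => hc x (Finsupp.support_smul hx), fun u hu => ?_⟩
  beta_reduce
  rw [hc' u hu, Finset.mul_sum]
  have h := Finsupp.sum_smul_index' (g := c) (b := r) (h := fun (x : ℕ × ℤ) (a : ℝ) =>
      (a : ℂ) * (logTerm u ^ x.1 * (1 - u) ^ (-x.2 - 1))) (by simp)
  refine Eq.trans ?_ h.symm
  refine Finset.sum_congr rfl fun x _ => ?_
  simp only [smul_eq_mul]
  push_cast
  ring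

theorem isLowerOrder_single {p q : ℤ} {i : ℕ} {j : ℤ} (h : j < q ∨ j = q ∧ (i : ℤ) ≤ p) :
    IsLowerOrder p q fun u => logTerm u ^ i * (1 - u) ^ (-j - 1) := by
  classical
  refine ⟨Finsupp.single (i, j) 1, fun x hx => ?_, fun u _ => ?_⟩
  · have := Finset.mem_singleton.1 (Finsupp.support_single_subset hx)
    subst this
    exact h
  · rw [Finsupp.support_single _ one_ne_zero]
    simp

/-- Indices shift by one: pole order `j` here is the exponent `-(j-1)-1` in `IsLowerOrder`, and the
strict bound `i < p` becomes `i ≤ p - 1`. -/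
theorem exists_isLowerOrder_of_mem {m p : ℕ} {f : ℝ⟦X⟧} (hf : f ∈ lowSpan 1 (m + 1) p) :
    ∃ R : ℂ → ℂ, IsLowerOrder ((p : ℤ) - 1) m R ∧ ∀ u : ℂ, ‖u‖ < 1 → HasAbsSum f u (R u) := by
  refine Submodule.span_induction ?_ ⟨fun _ => 0, IsLowerOrder.zero _ _, ?_⟩ ?_ ?_ hf
  · rintro _ ⟨i, j, hd, hj, rfl⟩
    refine ⟨_, isLowerOrder_single (i := i) (j := (j : ℤ) - 1) (by omega), fun u hu => ?_⟩
    have h := hasAbsSum_logGeom i j hu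
    have e : -((j : ℤ) - 1) - 1 = -(j : ℤ) := by ring
    rwa [e, zpow_neg, zpow_natCast, ← inv_pow]
  · intro u _
    simpa using (hasAbsSum_one u).smul 0
  · rintro f g _ _ ⟨R, hR, hR'⟩ ⟨S, hS, hS'⟩
    exact ⟨_, hR.add hS, fun u hu => (hR' u hu).add (hS' u hu)⟩
  · rintro r f _ ⟨R, hR, hR'⟩
    exact ⟨_, hR.smul r, fun u hu => (hR' u hu).smul r⟩

theorem coeff_momentSeries (s n : ℕ) :
    coeff n (momentSeries s) = quicksortMoment s n / (s.factorial : ℝ) := by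
  rw [momentSeries, coeff_mk, binomialMoment]

theorem quicksortGF_expansion (p : ℕ) : ∃ R : ℂ → ℂ, IsLowerOrder ((p : ℤ) - 1) ((p : ℤ) + 1) R ∧
    ∀ u : ℂ, ‖u‖ < 1 →
      HasSum (fun n : ℕ => (quicksortMoment (p + 1) n : ℂ) * u ^ n)
        (2 ^ (p + 1) * ((p + 1).factorial : ℂ) / (1 - u) ^ (p + 2) * logTerm u ^ (p + 1)
          + ((p + 1 : ℕ) : ℂ) * ((harmonic (p + 1) : ℂ) - 2) * 2 ^ (p + 1) *
            ((p + 1).factorial : ℂ) / (1 - u) ^ (p + 2) * logTerm u ^ p + R u) := by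
  obtain ⟨R, hR, hR'⟩ := exists_isLowerOrder_of_mem (hasTop_momentSeries p)
  have hR1 := hR.smul ((p + 1).factorial : ℝ)
  refine ⟨_, by exact_mod_cast hR1, fun u hu => ?_⟩
  have h := ((hR' u hu).add (((hasAbsSum_logGeom (p + 1) (p + 2) hu).smul (2 ^ (p + 1))).add
    ((hasAbsSum_logGeom p (p + 2) hu).smul (secondCoeff (p + 1))))).2
  rw [sub_add_cancel] at h
  have h' := h.mul_left ((p + 1).factorial : ℂ)
  have hfac : ((p + 1).factorial : ℂ) ≠ 0 := by exact_mod_cast (p + 1).factorial_ne_zero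
  have e1 : (fun n : ℕ => (quicksortMoment (p + 1) n : ℂ) * u ^ n) = fun n : ℕ =>
      ((p + 1).factorial : ℂ) * (((coeff n (momentSeries (p + 1)) : ℝ) : ℂ) * u ^ n) := by
    funext n
    rw [coeff_momentSeries]
    push_cast
    field_simp
  rw [e1]
  refine (congrArg (HasSum _) ?_).mp h'
  simp only [secondCoeff]
  push_cast
  rw [inv_pow]
  ring

end Evaluation

/-! ### Coefficients of `L^i/(1-u)` compared with powers of harmonic numbers. -/

section LogCoefficients

open PowerSeries

theorem coeff_zero_logGeom_succ (i j : ℕ) : coeff 0 (logGeom (i + 1) j) = 0 := by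
  simp [logGeom, logSeries]

theorem coeff_logGeom_zero_one (n : ℕ) : coeff n (logGeom 0 1) = 1 := by
  simp [logGeom, geomSeries]

/-- Multiplication by `1 - u` takes first differences and leaves `L^(i+1)`, whose derivative is
`(i+1) L^i/(1-u)`. -/
theorem coeff_succ_logGeom_one (i n : ℕ) : coeff (n + 1) (logGeom (i + 1) 1) =
    coeff n (logGeom (i + 1) 1) + ((i : ℝ) + 1) * ((n : ℝ) + 1)⁻¹ * coeff n (logGeom i 1) := by
  have h1 : logGeom (i + 1) 1 = X * logGeom (i + 1) 1 + logGeom (i + 1) 0 := by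
    have h := X_mul_geomSeries_pow_succ 0
    simp only [logGeom]
    linear_combination (-logSeries ^ (i + 1)) * h
  have h2 := congrArg (coeff n) (derivative_logGeom_succ i 0)
  rw [coeff_derivative] at h2
  simp only [Nat.cast_zero, zero_smul, add_zero, zero_add, map_smul, smul_eq_mul] at h2
  have h3 := congrArg (coeff (n + 1)) h1
  rw [map_add, coeff_succ_X_mul] at h3
  rw [h3]
  have hn : (n : ℝ) + 1 ≠ 0 := by positivity
  field_simp
  linear_combination h2

theorem coeff_logGeom_one_one (n : ℕ) : coeff n (logGeom 1 1) = (harmonic n : ℝ) := by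
  induction n with
  | zero => simp [coeff_zero_logGeom_succ 0]
  | succ n ih =>
    rw [coeff_succ_logGeom_one 0, ih, coeff_logGeom_zero_one, harmonic_succ]
    push_cast
    ring

theorem pow_sub_pow_le_mul {x y : ℝ} (hx : 0 ≤ x) (hxy : x ≤ y) (k : ℕ) :
    y ^ (k + 1) - x ^ (k + 1) ≤ (k + 1) * (y - x) * y ^ k := by
  induction k with
  | zero => simp
  | succ k ih =>
    have hy : 0 ≤ y := hx.trans hxy
    have h1 := mul_le_mul_of_nonneg_right ih hy
    have h2 := mul_le_mul_of_nonneg_left (pow_le_pow_left₀ hx hxy (k + 1)) (sub_nonneg.2 hxy)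
    push_cast
    calc y ^ (k + 1 + 1) - x ^ (k + 1 + 1)
        = (y ^ (k + 1) - x ^ (k + 1)) * y + (y - x) * x ^ (k + 1) := by ring
      _ ≤ (k + 1) * (y - x) * y ^ k * y + (y - x) * y ^ (k + 1) := add_le_add h1 h2
      _ = _ := by ring

theorem mul_le_pow_sub_pow {x y : ℝ} (hx : 0 ≤ x) (hxy : x ≤ y) (k : ℕ) :
    (k + 1) * (y - x) * x ^ k ≤ y ^ (k + 1) - x ^ (k + 1) := by
  induction k with
  | zero => simp
  | succ k ih =>
    have h1 := mul_le_mul_of_nonneg_right ih hx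
    have h2 := mul_le_mul_of_nonneg_left (pow_le_pow_left₀ hx hxy (k + 1)) (sub_nonneg.2 hxy)
    push_cast
    calc ((k : ℝ) + 1 + 1) * (y - x) * x ^ (k + 1)
        = (k + 1) * (y - x) * x ^ k * x + (y - x) * x ^ (k + 1) := by ring
      _ ≤ (y ^ (k + 1) - x ^ (k + 1)) * x + (y - x) * y ^ (k + 1) := add_le_add h1 h2
      _ = _ := by ring

theorem pow_sub_pow_sub_le {x y : ℝ} (hx : 0 ≤ x) (hxy : x ≤ y) (k : ℕ) :
    y ^ (k + 2) - x ^ (k + 2) - (k + 2) * (y - x) * x ^ (k + 1) ≤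
      (k + 2) * (k + 1) * (y - x) ^ 2 * y ^ k := by
  have h1 := pow_sub_pow_le_mul hx hxy (k + 1)
  have h2 := pow_sub_pow_le_mul hx hxy k
  have h3 := mul_le_mul_of_nonneg_left h2
    (mul_nonneg (by positivity : (0 : ℝ) ≤ k + 2) (sub_nonneg.2 hxy))
  push_cast at h1
  calc y ^ (k + 2) - x ^ (k + 2) - (k + 2) * (y - x) * x ^ (k + 1)
      ≤ (k + 2) * (y - x) * (y ^ (k + 1) - x ^ (k + 1)) := by linarith
    _ ≤ _ := h3
    _ = _ := by ring

theorem harmonic_cast_nonneg (n : ℕ) : (0 : ℝ) ≤ (harmonic n : ℝ) := by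
  simp only [harmonic]
  push_cast
  positivity

theorem harmonic_cast_succ (n : ℕ) :
    (harmonic (n + 1) : ℝ) = (harmonic n : ℝ) + ((n : ℝ) + 1)⁻¹ := by
  rw [harmonic_succ]
  push_cast
  rfl

theorem harmonic_cast_mono : Monotone fun n : ℕ => (harmonic n : ℝ) :=
  monotone_nat_of_le_succ fun n => by
    rw [harmonic_cast_succ]
    linarith [inv_nonneg.2 (by positivity : (0 : ℝ) ≤ (n : ℝ) + 1)]

/-- The difference between a power of the harmonic number and the coefficient of
`L(u) ^ i / (1 - u)`. -/
noncomputable def harmonicDefect (i n : ℕ) : ℝ :=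
  (harmonic n : ℝ) ^ i - coeff n (logGeom i 1)

theorem harmonicDefect_zero_right (i : ℕ) : harmonicDefect (i + 1) 0 = 0 := by
  simp [harmonicDefect, coeff_zero_logGeom_succ]

theorem harmonicDefect_succ (k n : ℕ) : harmonicDefect (k + 2) (n + 1) =
    harmonicDefect (k + 2) n + ((k : ℝ) + 2) * ((n : ℝ) + 1)⁻¹ * harmonicDefect (k + 1) n +
      ((harmonic (n + 1) : ℝ) ^ (k + 2) - (harmonic n : ℝ) ^ (k + 2) -
        (k + 2) * ((harmonic (n + 1) : ℝ) - harmonic n) * (harmonic n : ℝ) ^ (k + 1)) := by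
  simp only [harmonicDefect]
  rw [coeff_succ_logGeom_one (k + 1), harmonic_cast_succ]
  push_cast
  ring

/-- By convexity of powers the inhomogeneous term in `harmonicDefect_succ` is nonnegative. -/
theorem harmonicDefect_nonneg (k n : ℕ) : 0 ≤ harmonicDefect (k + 1) n := by
  induction k generalizing n with
  | zero => simp [harmonicDefect, coeff_logGeom_one_one]
  | succ k ih =>
    induction n with
    | zero => rw [harmonicDefect_zero_right]
    | succ n ihn =>
      rw [harmonicDefect_succ]
      have h := mul_le_pow_sub_pow (harmonic_cast_nonneg n) (harmonic_cast_mono n.le_succ) (k + 1)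
      push_cast at h
      have h1 := mul_nonneg (by positivity : (0 : ℝ) ≤ ((k : ℝ) + 2) * ((n : ℝ) + 1)⁻¹) (ih n)
      refine add_nonneg (add_nonneg ihn h1) ?_
      rw [sub_nonneg]
      refine le_trans (le_of_eq ?_) h
      ring

/-- Summing `harmonicDefect_succ`, the increments `1/(n+1)` add up to the harmonic number, while the
Taylor remainders are of order `1/(n+1)^2` and are dominated by the telescoping `2/(n+1) - 2/(n+2)`.
-/
theorem harmonicDefect_le_of_le (k N : ℕ) {B : ℝ} (hB : ∀ n ≤ N, harmonicDefect (k + 1) n ≤ B) :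
    harmonicDefect (k + 2) N ≤
      (k + 2) * B * (harmonic N : ℝ) + (k + 2) * (k + 1) * 2 * (harmonic N : ℝ) ^ k := by
  have key : ∀ n ≤ N, harmonicDefect (k + 2) n ≤ (k + 2) * B * (harmonic n : ℝ) +
      (k + 2) * (k + 1) * (2 - 2 * ((n : ℝ) + 1)⁻¹) * (harmonic N : ℝ) ^ k := by
    intro n
    induction n with
    | zero =>
      intro _
      rw [harmonicDefect_zero_right]
      have := pow_nonneg (harmonic_cast_nonneg N) k
      norm_num
    | succ n ih =>
      intro hn
      rw [harmonicDefect_succ]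
      have h1 := ih (by omega)
      have h2 := mul_le_mul_of_nonneg_left (hB n (by omega))
        (by positivity : (0 : ℝ) ≤ ((k : ℝ) + 2) * ((n : ℝ) + 1)⁻¹)
      have hmono : (harmonic n : ℝ) ≤ (harmonic (n + 1) : ℝ) := harmonic_cast_mono n.le_succ
      have h3 := pow_sub_pow_sub_le (harmonic_cast_nonneg n) hmono k
      have h4 : (k + 2) * (k + 1) * ((harmonic (n + 1) : ℝ) - harmonic n) ^ 2 *
          (harmonic (n + 1) : ℝ) ^ k ≤ (k + 2) * (k + 1) *
          (2 * (((n : ℝ) + 1)⁻¹ - ((n : ℝ) + 1 + 1)⁻¹)) * (harmonic N : ℝ) ^ k := by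
        have h5 : (harmonic (n + 1) : ℝ) ≤ (harmonic N : ℝ) := harmonic_cast_mono hn
        have h6 : (((n : ℝ) + 1)⁻¹) ^ 2 ≤ 2 * (((n : ℝ) + 1)⁻¹ - ((n : ℝ) + 1 + 1)⁻¹) := by
          rw [← sub_nonneg]
          have e : 2 * (((n : ℝ) + 1)⁻¹ - ((n : ℝ) + 1 + 1)⁻¹) - (((n : ℝ) + 1)⁻¹) ^ 2 =
              n / (((n : ℝ) + 1) ^ 2 * ((n : ℝ) + 1 + 1)) := by
            field_simp
            ring
          rw [e]
          positivity
        have h7 : (harmonic (n + 1) : ℝ) - harmonic n = ((n : ℝ) + 1)⁻¹ := by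
          rw [harmonic_cast_succ, add_sub_cancel_left]
        have h8 := pow_le_pow_left₀ (harmonic_cast_nonneg (n + 1)) h5 k
        rw [h7]
        exact mul_le_mul (mul_le_mul_of_nonneg_left h6 (by positivity)) h8
          (pow_nonneg (harmonic_cast_nonneg _) k)
          (mul_nonneg (by positivity) ((sq_nonneg _).trans h6))
      refine (add_le_add (add_le_add h1 h2) (h3.trans h4)).trans (le_of_eq ?_)
      rw [harmonic_cast_succ]
      push_cast
      ring
  refine (key N le_rfl).trans ?_
  have h := pow_nonneg (harmonic_cast_nonneg N) k
  gcongr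
  linarith [inv_nonneg.2 (by positivity : (0 : ℝ) ≤ (N : ℝ) + 1)]

theorem exists_harmonicDefect_le (i : ℕ) :
    ∃ C : ℝ, ∀ n, harmonicDefect (i + 2) n ≤ C * (harmonic n : ℝ) ^ i := by
  induction i with
  | zero =>
    refine ⟨4, fun n => ?_⟩
    have h := harmonicDefect_le_of_le 0 n (B := 0) fun m _ => by
      simp [harmonicDefect, coeff_logGeom_one_one]
    norm_num at h ⊢
    linarith
  | succ i ih =>
    obtain ⟨C, hC⟩ := ih
    refine ⟨(i + 3) * |C| + (i + 3) * (i + 2) * 2, fun n => ?_⟩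
    have h := harmonicDefect_le_of_le (i + 1) n (B := |C| * (harmonic n : ℝ) ^ i) fun m hm =>
      (hC m).trans (mul_le_mul (le_abs_self C)
        (pow_le_pow_left₀ (harmonic_cast_nonneg m) (harmonic_cast_mono hm) i)
        (pow_nonneg (harmonic_cast_nonneg m) i) (abs_nonneg C))
    refine h.trans (le_of_eq ?_)
    push_cast
    ring

/-- `j c(i, j) = (n + j) c(i, j - 1) + i c(i - 1, j - 1) - i c(i - 1, j)` for the coefficients of
`L(u) ^ i * (1 - u) ^ (-j - 1)`. -/
theorem coeff_logGeom_recursion (i j n : ℕ) :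
    ((j : ℝ) + 1) * coeff n (logGeom i (j + 2)) =
      (n + (j + 1)) * coeff n (logGeom i (j + 1)) + i * coeff n (logGeom (i - 1) (j + 1)) -
        i * coeff n (logGeom (i - 1) (j + 2)) := by
  have h := congrArg (coeff n) (X_mul_derivative_logGeom i (j + 1))
  rw [coeff_X_mul_derivative] at h
  simp only [map_add, map_sub, map_smul, smul_eq_mul] at h
  push_cast at h
  linear_combination -h

end LogCoefficients

/-! ### Two-term asymptotics on the scale `n^j log^i n`. -/

section LogAsymptotics

open PowerSeries

/-- The comparison scale `n ^ j * log n ^ i`. -/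
noncomputable def logScale (j : ℕ) (i : ℤ) (n : ℕ) : ℝ := (n : ℝ) ^ j * Real.log n ^ i

theorem eventually_log_ge_one : ∀ᶠ n : ℕ in atTop, 1 ≤ Real.log n :=
  (Real.tendsto_log_atTop.comp tendsto_natCast_atTop_atTop).eventually_ge_atTop 1

theorem logScale_mul (j j' : ℕ) (i i' : ℤ) :
    (fun n => logScale j i n * logScale j' i' n) =ᶠ[atTop] logScale (j + j') (i + i') := by
  filter_upwards [eventually_log_ge_one] with n hn
  rw [logScale, logScale, logScale, zpow_add₀ (by linarith), pow_add]
  ring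

theorem logScale_isBigO_of_le (j : ℕ) {i i' : ℤ} (h : i ≤ i') :
    logScale j i =O[atTop] logScale j i' := by
  refine IsBigO.of_bound 1 ?_
  filter_upwards [eventually_log_ge_one] with n hn
  simp only [logScale, norm_mul, one_mul, norm_zpow]
  gcongr
  rwa [Real.norm_of_nonneg (by linarith)]

theorem logScale_isBigO_one (k : ℤ) : logScale 0 k =O[atTop] logScale 1 0 := by
  refine (logScale_isBigO_of_le 0 (Int.self_le_toNat k)).trans ?_
  have h := ((Real.isLittleO_pow_log_id_atTop (n := k.toNat)).comp_tendsto
    tendsto_natCast_atTop_atTop).isBigO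
  refine h.congr (fun n => ?_) fun n => ?_
  · rw [logScale, zpow_natCast]
    simp
  · simp [logScale]

theorem logScale_isBigO {j j' : ℕ} {i i' : ℤ} (h : j < j' ∨ j = j' ∧ i ≤ i') :
    logScale j i =O[atTop] logScale j' i' := by
  rcases h with h | ⟨rfl, h⟩
  · obtain ⟨d, rfl⟩ : ∃ d, j' = j + 1 + d := ⟨j' - (j + 1), by omega⟩
    have h1 := (isBigO_refl (logScale j i') atTop).mul (logScale_isBigO_one (i - i'))
    have h2 : logScale j i =O[atTop] logScale (j + 1) i' := by
      refine h1.congr' ((logScale_mul _ _ _ _).trans (by simp)) ((logScale_mul _ _ _ _).trans ?_)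
      simp
    refine h2.trans (IsBigO.of_bound 1 ?_)
    filter_upwards [eventually_ge_atTop 1] with n hn
    simp only [logScale, norm_mul, one_mul, norm_pow]
    gcongr ?_ * _
    refine pow_le_pow_right₀ ?_ (by omega)
    simpa using hn
  · exact logScale_isBigO_of_le j h

/-- `f n = n ^ j * (α * log n ^ i + β * log n ^ (i - 1) + O(log n ^ (i - 2)))`. -/
def HasLogAsymp (j : ℕ) (i : ℤ) (α β : ℝ) (f : ℕ → ℝ) : Prop :=
  (fun n => f n - (α * logScale j i n + β * logScale j (i - 1) n)) =O[atTop] logScale j (i - 2)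

theorem HasLogAsymp.add {j : ℕ} {i : ℤ} {α β α' β' : ℝ} {f g : ℕ → ℝ}
    (hf : HasLogAsymp j i α β f) (hg : HasLogAsymp j i α' β' g) :
    HasLogAsymp j i (α + α') (β + β') fun n => f n + g n :=
  (IsBigO.add hf hg).congr_left fun n => by ring

theorem HasLogAsymp.const_mul {j : ℕ} {i : ℤ} {α β : ℝ} {f : ℕ → ℝ} (c : ℝ)
    (hf : HasLogAsymp j i α β f) : HasLogAsymp j i (c * α) (c * β) fun n => c * f n :=
  (IsBigO.const_mul_left hf c).congr_left fun n => by ring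

theorem hasLogAsymp_of_isBigO {j : ℕ} {i : ℤ} {f : ℕ → ℝ}
    (hf : f =O[atTop] logScale j (i - 2)) : HasLogAsymp j i 0 0 f :=
  hf.congr_left fun n => by ring

theorem HasLogAsymp.isBigO {j : ℕ} {i : ℤ} {α β : ℝ} {f : ℕ → ℝ} (hf : HasLogAsymp j i α β f) :
    f =O[atTop] logScale j i := by
  have h1 := IsBigO.trans hf (logScale_isBigO (i' := i) (Or.inr ⟨rfl, by omega⟩))
  have h2 := (isBigO_refl (logScale j i) atTop).const_mul_left α
  have h3 := (logScale_isBigO (j := j) (i := i - 1) (i' := i)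
    (Or.inr ⟨rfl, by omega⟩)).const_mul_left β
  exact (h1.add (h2.add h3)).congr_left fun n => by ring

theorem HasLogAsymp.raise {j : ℕ} {i : ℤ} {α β : ℝ} {f : ℕ → ℝ} (hf : HasLogAsymp j i α β f) :
    HasLogAsymp j (i + 1) 0 α f := by
  have h1 := IsBigO.trans hf (logScale_isBigO (j' := j) (i' := i + 1 - 2)
    (Or.inr ⟨rfl, by omega⟩))
  have h2 := (isBigO_refl (logScale j (i - 1)) atTop).const_mul_left β
  rw [show i - 1 = i + 1 - 2 by ring] at h2
  refine (h1.add h2).congr_left fun n => ?_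
  rw [show i - 1 = i + 1 - 2 by ring, show i + 1 - 1 = i by ring]
  ring

theorem HasLogAsymp.mul {j j' : ℕ} {i i' : ℤ} {α β α' β' : ℝ} {f g : ℕ → ℝ}
    (hf : HasLogAsymp j i α β f) (hg : HasLogAsymp j' i' α' β' g) :
    HasLogAsymp (j + j') (i + i') (α * α') (α * β' + β * α') fun n => f n * g n := by
  have h1 := (IsBigO.mul hf hg.isBigO).congr' EventuallyEq.rfl (logScale_mul _ _ _ _)
  have h0 : HasLogAsymp j i α β fun n => α * logScale j i n + β * logScale j (i - 1) n := by
    unfold HasLogAsymp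
    simp only [sub_self]
    exact isBigO_zero _ _
  have h2 := (IsBigO.mul h0.isBigO hg).congr' EventuallyEq.rfl (logScale_mul _ _ _ _)
  have h3 := (isBigO_refl (logScale (j + j') (i + i' - 2)) atTop).const_mul_left (β * β')
  rw [show i - 2 + i' = i + i' - 2 by ring] at h1
  rw [show i + (i' - 2) = i + i' - 2 by ring] at h2
  refine ((h1.add h2).add h3).congr' ?_ EventuallyEq.rfl
  have e1 := logScale_mul j j' i i'
  have e2 := logScale_mul j j' (i - 1) i'
  have e3 := logScale_mul j j' i (i' - 1)
  have e4 := logScale_mul j j' (i - 1) (i' - 1)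
  rw [show i - 1 + i' = i + i' - 1 by ring] at e2
  rw [show i + (i' - 1) = i + i' - 1 by ring] at e3
  rw [show i - 1 + (i' - 1) = i + i' - 2 by ring] at e4
  filter_upwards [e1, e2, e3, e4] with n h1 h2 h3 h4
  linear_combination -(α * α') * h1 - β * α' * h2 - α * β' * h3 - β * β' * h4

theorem hasLogAsymp_logScale (j : ℕ) (i : ℤ) : HasLogAsymp j i 1 0 (logScale j i) := by
  unfold HasLogAsymp
  simp only [one_mul, zero_mul, add_zero, sub_self]
  exact isBigO_zero _ _

theorem hasLogAsymp_natCast : HasLogAsymp 1 0 1 0 fun n => (n : ℝ) := by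
  have h := hasLogAsymp_logScale 1 0
  have e : logScale 1 0 = fun n : ℕ => (n : ℝ) := by
    funext n
    simp [logScale]
  rwa [e] at h

theorem hasLogAsymp_one : HasLogAsymp 0 0 1 0 fun _ => 1 := by
  have h := hasLogAsymp_logScale 0 0
  have e : logScale 0 0 = fun _ : ℕ => (1 : ℝ) := by
    funext n
    simp [logScale]
  rwa [e] at h

/-- The two Euler–Mascheroni sequences bracket `γ`, giving `0 < H_n - log n - γ < log(n+1) - log n ≤
1/n`, and `1/n` is `O(1/log n)`. -/
theorem hasLogAsymp_harmonic :
    HasLogAsymp 0 1 1 Real.eulerMascheroniConstant fun n => (harmonic n : ℝ) := by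
  have h1 : (fun n : ℕ => (harmonic n : ℝ) -
      (1 * logScale 0 1 n + Real.eulerMascheroniConstant * logScale 0 (1 - 1) n))
      =O[atTop] fun n : ℕ => ((n : ℝ))⁻¹ := by
    refine IsBigO.of_bound 1 ?_
    filter_upwards [eventually_ge_atTop 1] with n hn
    have hn0 : (0 : ℝ) < n := by exact_mod_cast hn
    have ha := Real.eulerMascheroniSeq_lt_eulerMascheroniConstant n
    have hb := Real.eulerMascheroniConstant_lt_eulerMascheroniSeq' n
    rw [Real.eulerMascheroniSeq] at ha
    rw [Real.eulerMascheroniSeq', if_neg (by omega)] at hb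
    have hc : Real.log (n + 1) - Real.log n ≤ (n : ℝ)⁻¹ := by
      rw [← Real.log_div (by positivity) hn0.ne']
      refine (Real.log_le_sub_one_of_pos (by positivity)).trans (le_of_eq ?_)
      field_simp
      ring
    have e : (harmonic n : ℝ) - (1 * logScale 0 1 n +
        Real.eulerMascheroniConstant * logScale 0 (1 - 1) n) =
        harmonic n - Real.log n - Real.eulerMascheroniConstant := by
      simp [logScale]
      ring
    rw [e, one_mul, Real.norm_of_nonneg (by linarith), Real.norm_of_nonneg (by positivity)]
    linarith
  refine h1.trans ?_
  have h2 := (logScale_isBigO (j := 0) (j' := 1) (i := 1) (i' := 0) (by omega)).inv_rev (by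
    filter_upwards [eventually_log_ge_one] with n hn h0
    simp [logScale] at h0
    rcases h0 with h0 | h0 | h0
    · rw [h0] at hn; norm_num at hn
    · rw [h0] at hn; norm_num at hn
    · rw [h0] at hn; norm_num at hn)
  refine h2.congr (fun n => by simp [logScale]) fun n => ?_
  simp [logScale]

theorem hasLogAsymp_harmonic_pow (i : ℕ) :
    HasLogAsymp 0 i 1 (i * Real.eulerMascheroniConstant) fun n => (harmonic n : ℝ) ^ i := by
  induction i with
  | zero => simpa using hasLogAsymp_one
  | succ i ih =>
    have h := ih.mul hasLogAsymp_harmonic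
    simp only [← pow_succ] at h
    convert h using 1 <;> push_cast <;> ring

theorem hasLogAsymp_coeff_logGeom_one (i : ℕ) :
    HasLogAsymp 0 i 1 (i * Real.eulerMascheroniConstant) fun n => coeff n (logGeom i 1) := by
  have h : HasLogAsymp 0 i 0 0 fun n => -1 * harmonicDefect i n := by
    refine hasLogAsymp_of_isBigO (IsBigO.const_mul_left ?_ _)
    rcases i with _ | _ | i
    · have : harmonicDefect 0 = fun _ => 0 := by
        funext n
        simp [harmonicDefect, coeff_logGeom_zero_one]
      rw [this]
      exact isBigO_zero _ _
    · have : harmonicDefect 1 = fun _ => 0 := by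
        funext n
        simp [harmonicDefect, coeff_logGeom_one_one]
      rw [zero_add, this]
      exact isBigO_zero _ _
    · obtain ⟨C, hC⟩ := exists_harmonicDefect_le i
      have h1 : harmonicDefect (i + 2) =O[atTop] fun n => (harmonic n : ℝ) ^ i := by
        refine IsBigO.of_bound C (Eventually.of_forall fun n => ?_)
        rw [Real.norm_of_nonneg (harmonicDefect_nonneg (i + 1) n),
          Real.norm_of_nonneg (pow_nonneg (harmonic_cast_nonneg n) i)]
        exact hC n
      have h2 := h1.trans (hasLogAsymp_harmonic_pow i).isBigO
      rwa [show ((i + 1 + 1 : ℕ) : ℤ) - 2 = i by push_cast; ring]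
  have h' := (hasLogAsymp_harmonic_pow i).add h
  simp only [add_zero, harmonicDefect] at h'
  convert h' using 2
  ring

/-- The two leading terms of the coefficients of `L(u) ^ i * (1 - u) ^ (-j - 1)`. -/
theorem hasLogAsymp_coeff_logGeom (j i : ℕ) :
    HasLogAsymp j i (j.factorial : ℝ)⁻¹
      (i * (Real.eulerMascheroniConstant - harmonic j) * (j.factorial : ℝ)⁻¹)
      fun n => coeff n (logGeom i (j + 1)) := by
  induction j generalizing i with
  | zero => simpa using hasLogAsymp_coeff_logGeom_one i
  | succ j ihj =>
    induction i using Nat.strong_induction_on with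
    | _ i ihi =>
    have hsmall : ∀ (c : ℝ) (i' : ℕ),
        HasLogAsymp (j + 1) i 0 0 fun n => c * coeff n (logGeom i' (j + 1)) := fun c i' =>
      hasLogAsymp_of_isBigO (((ihj i').isBigO.trans (logScale_isBigO (by omega))).const_mul_left c)
    have hmain := hasLogAsymp_natCast.mul (ihj i)
    rw [zero_add, add_comm 1 j] at hmain
    -- This term has the same power of `n` and one logarithm less; after division by `j + 1` it
    -- turns `γ - H_j` into `γ - H_{j+1}`.
    have hlast : ∀ c : ℝ, c = -i → HasLogAsymp (j + 1) i 0 (c * ((j + 1).factorial : ℝ)⁻¹)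
        fun n => c * coeff n (logGeom (i - 1) (j + 2)) := by
      intro c hc
      rcases i with _ | i
      · have hc0 : c = 0 := by rw [hc, Nat.cast_zero, neg_zero]
        subst hc0
        simp only [zero_mul]
        exact hasLogAsymp_of_isBigO (isBigO_zero _ _)
      · have h := ((ihi i i.lt_succ_self).raise).const_mul c
        rwa [mul_zero] at h
    have h := (((hmain.add (hsmall (j + 1) i)).add (hsmall i (i - 1))).add
      (hlast _ rfl)).const_mul ((j : ℝ) + 1)⁻¹
    have hj : (j : ℝ) + 1 ≠ 0 := by positivity
    convert h using 1
    · rw [Nat.factorial_succ]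
      push_cast
      field_simp
      ring
    · rw [Nat.factorial_succ, harmonic_cast_succ]
      push_cast
      field_simp
      ring
    · funext n
      have hrec := coeff_logGeom_recursion i j n
      field_simp
      linear_combination hrec

end LogAsymptotics

/-! ### Asymptotics of the factorial moments. -/

section MomentAsymptotics

open PowerSeries

/-- The lower bound `1` on the pole order is what makes `hasLogAsymp_coeff_logGeom` available for
every generator. -/
theorem coeff_isBigO_of_mem_lowSpan {m p : ℕ} {f : ℝ⟦X⟧} (hf : f ∈ lowSpan 1 (m + 1) p) :
    (fun n => coeff n f) =O[atTop] logScale m ((p : ℤ) - 1) := by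
  refine Submodule.span_induction ?_ ?_ ?_ ?_ hf
  · rintro _ ⟨i, j, hd, hj, rfl⟩
    obtain ⟨k, rfl⟩ : ∃ k, j = k + 1 := ⟨j - 1, by omega⟩
    exact (hasLogAsymp_coeff_logGeom k i).isBigO.trans (logScale_isBigO (by omega))
  · simp only [map_zero]
    exact isBigO_zero _ _
  · intro f g _ _ hf hg
    simp only [map_add]
    exact hf.add hg
  · intro r f _ hf
    simp only [map_smul, smul_eq_mul]
    exact hf.const_mul_left r

/-- With `s = p + 1`, the leading series contributes `2^s s (γ - H_s)` to the second coefficient and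
the next one `2^s s (H_s - 2)`, so `H_s` cancels. -/
theorem hasLogAsymp_quicksortMoment (p : ℕ) :
    HasLogAsymp (p + 1) ((p : ℤ) + 1) (2 ^ (p + 1))
      (2 ^ (p + 1) * ((p : ℝ) + 1) * (Real.eulerMascheroniConstant - 2))
      (quicksortMoment (p + 1)) := by
  have h1 := (hasLogAsymp_coeff_logGeom (p + 1) (p + 1)).const_mul (2 ^ (p + 1))
  have h2 := ((hasLogAsymp_coeff_logGeom (p + 1) p).raise).const_mul (secondCoeff (p + 1))
  have h3 : HasLogAsymp (p + 1) ((p : ℤ) + 1) 0 0 fun n =>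
      coeff n (momentSeries (p + 1) - ((2 ^ (p + 1) : ℝ) • logGeom (p + 1) (p + 2) +
        secondCoeff (p + 1) • logGeom p (p + 2))) := by
    refine hasLogAsymp_of_isBigO ?_
    rw [show (p : ℤ) + 1 - 2 = p - 1 by ring]
    exact coeff_isBigO_of_mem_lowSpan (hasTop_momentSeries p)
  rw [Nat.cast_succ (R := ℤ)] at h1
  have h := ((h1.add h2).add h3).const_mul ((p + 1).factorial : ℝ)
  have hfac : ((p + 1).factorial : ℝ) ≠ 0 := by positivity
  convert h using 1
  · field_simp
    ring
  · simp only [secondCoeff]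
    push_cast
    field_simp
    ring
  · funext n
    simp only [map_sub, map_add, map_smul, smul_eq_mul, coeff_momentSeries]
    field_simp
    ring

end MomentAsymptotics

/-! ### The main theorem. -/

theorem mainTheorem3 (s : ℕ) (hs : 1 ≤ s) :
    (∃ R : ℂ → ℂ, IsLowerOrder ((s : ℤ) - 2) (s : ℤ) R ∧
      ∀ u : ℂ, ‖u‖ < 1 →
        Summable (fun n : ℕ => (quicksortMoment s n : ℂ) * u ^ n) ∧
        quicksortGF s u =
          2 ^ s * (s.factorial : ℂ) / (1 - u) ^ (s + 1) * logTerm u ^ s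
          + (s : ℂ) * ((harmonic s : ℂ) - 2) * 2 ^ s * (s.factorial : ℂ) / (1 - u) ^ (s + 1)
              * logTerm u ^ (s - 1)
          + R u) ∧
    (fun n : ℕ => quicksortMoment s n
        - (2 ^ s * (n : ℝ) ^ s * Real.log n ^ s
          + 2 ^ s * (s : ℝ) * (Real.eulerMascheroniConstant - 2) * (n : ℝ) ^ s
              * Real.log n ^ (s - 1)))
      =O[atTop] (fun n : ℕ => (n : ℝ) ^ s * Real.log n ^ ((s : ℤ) - 2)) := by
  obtain ⟨p, rfl⟩ : ∃ p, s = p + 1 := ⟨s - 1, by omega⟩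
  constructor
  · obtain ⟨R, hR, hR'⟩ := quicksortGF_expansion p
    refine ⟨R, ?_, fun u hu => ⟨(hR' u hu).summable, (hR' u hu).tsum_eq⟩⟩
    rw [show ((p + 1 : ℕ) : ℤ) - 2 = p - 1 by push_cast; ring, Nat.cast_succ]
    exact hR
  · refine (hasLogAsymp_quicksortMoment p).congr (fun n => ?_) fun n => ?_
    · have e1 : logScale (p + 1) ((p : ℤ) + 1) n = (n : ℝ) ^ (p + 1) * Real.log n ^ (p + 1) := by
        rw [logScale]
        exact_mod_cast rfl
      have e2 : logScale (p + 1) ((p : ℤ) + 1 - 1) n = (n : ℝ) ^ (p + 1) * Real.log n ^ p := by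
        rw [logScale, add_sub_cancel_right, zpow_natCast]
      rw [e1, e2, Nat.add_sub_cancel]
      push_cast
      ring
    · rw [logScale, Nat.cast_succ]
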